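/- Let $n\ge 4$ and let $\Delta\subset\mathbb R^n$ be a lattice polytope of dimension $n$, i.e. the convex hull of finitely many points of $\mathbb Z^n$, with non-empty interior. **Definitions.** Let $P\subset\mathbb R^n$ be a lattice polytope of dimension $n$. A *unimodular triangulation* $\Gamma$ of $P$ is a finite triangulation of $P$ with vertices in $\mathbb Z^n$ all of whose $n$-simplices have Euclidean volume $1/n!$. Write $F_k(\Gamma)$ for its set of $k$-simplices, and $F_k(\tau)$ for the set of $k$-faces of a simplex $\tau$. A lattice $n$-simplex is *unimodular* if it has volume $1/n!$. For a face $Q$ of $P$ or a simplex $Q$ of $\Gamma$, let $T(Q)\subset\mathbb Z^n$ be the sublattice spanned by the differences of two points of $Q\cap\mathbb Z^n$, let $T_2(Q)\subset\mathbb F_2^n$ be the subspace spanned by its reduction modulo $2$, and let $T_2^\perp(Q)\subset(\mathbb F_2^n)^\vee$ be the orthogonal of $T_2(Q)$. Let $\mathcal Q^n$ be the set of orthants of $\mathbb R^n$, seen as an affine space directed by $(\mathbb F_2^n)^\vee$. A *real phase structure* $\mathcal E$ on the $k$-skeleton of $\Gamma$ is a choice, for each $\sigma\in F_k(\Gamma)$,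 of an affine subspace $\mathcal E(\sigma)\subset\mathcal Q^n$ directed by $T_2^\perp(\sigma)$, such that for each $\tau\in F_{k+1}(\Gamma)$ and each $s\in\mathcal Q^n$ the number of $\sigma\in F_k(\tau)$ with $s\in\mathcal E(\sigma)$ is even. For any simplex $\tau$ of $\Gamma$ put $\mathcal E(\tau)=\bigcup_{\sigma\in F_k(\tau)}\mathcal E(\sigma)$. Let $\widetilde P$ be the quotient of $\bigsqcup_{s\in\mathcal Q^n}s(P)$, where each $s(P)$ is a copy of $P$, obtained by identifying $s(F)$ with $t(F)$ for each face $F$ of $P$ and all $s,t$ with $t-s\in T_2^\perp(F)$. The *T-manifold* $X_{\mathcal E}\subset\widetilde P$ is the union of the simplices of the barycentric subdivision of the induced triangulation of $\widetilde P$ all of whose vertices are barycenters of simplices $s(\sigma)$ with $s\in\mathcal E(\sigma)$. A *T-curve with Newton polytope $P$* is an $X_{\mathcal E}$ for a real phase structure $\mathcal E$ on the $(n-1)$-skeleton of a unimodular triangulation $\Gamma$ of $P$. The *dual graph* $G_\Gamma$ has a vertex $v_\tau$ for each $\tau\in F_n(\Gamma)$ and a vertex $u_\sigma$ for each $\sigma\in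 F_{n-1}(\Gamma)$ lying on the boundary of $P$; each $\sigma\in F_{n-1}(\Gamma)$ gives an edge, which joins $v_\tau$ and $v_{\tau'}$ if $\sigma$ is the common facet of the $n$-simplices $\tau\ne\tau'$, and joins $v_\tau$ and $u_\sigma$ if $\sigma$ is a facet of $\tau$ on the boundary of $P$. Let $b_1(G_\Gamma)$ be its first Betti number, and let $b_0(X_{\mathcal E})$ be the number of connected components of $X_{\mathcal E}$. The T-curve $X_{\mathcal E}$ is *maximal* if $b_0(X_{\mathcal E})=b_1(G_\Gamma)+1$. **Statement.** 1. If $\Delta$ has a lattice point in its interior, then no T-curve with Newton polytope $\Delta$ is maximal. 2. For every integer $d\ge n+1$, no T-curve with Newton polytope $d\Delta$ is maximal. 3. If $\Delta$ is not a unimodular simplex, then for every integer $d\ge n$ no T-curve with Newton polytope $d\Delta$ is maximal. -/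

import Mathlib

open MeasureTheory
open scoped Nat Pointwise

noncomputable section

namespace Patchworking

/-! ### Lattice polytopes and unimodular triangulations -/

/-- The inclusion of the lattice `ℤⁿ` into `ℝⁿ`. -/
def latticePoint {n : ℕ} (a : Fin n → ℤ) : Fin n → ℝ := fun i => (a i : ℝ)

/-- A full-dimensional convex polytope in `ℝⁿ` with vertices in `ℤⁿ`. -/
def IsLatticePolytope {n : ℕ} (Δ : Set (Fin n → ℝ)) : Prop :=
  (∃ S : Finset (Fin n → ℤ), Δ = convexHull ℝ (latticePoint '' (S : Set (Fin n → ℤ)))) ∧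
    (interior Δ).Nonempty

/-- The polytope has a lattice point in its interior. -/
def HasInteriorLatticePoint {n : ℕ} (Δ : Set (Fin n → ℝ)) : Prop :=
  ∃ a : Fin n → ℤ, latticePoint a ∈ interior Δ

/-- A unimodular simplex: a lattice `n`-simplex of euclidean volume `1 / n!`. -/
def IsUnimodularSimplex {n : ℕ} (Δ : Set (Fin n → ℝ)) : Prop :=
  ∃ σ : Finset (Fin n → ℝ), σ.card = n + 1 ∧
    AffineIndependent ℝ ((↑) : σ → (Fin n → ℝ)) ∧
    (∀ v ∈ σ, ∃ a : Fin n → ℤ, v = latticePoint a) ∧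
    Δ = convexHull ℝ (σ : Set (Fin n → ℝ)) ∧
    volume Δ = ENNReal.ofReal (1 / (n ! : ℝ))

/-- Simplicial complexes in `ℝⁿ`; a simplex is given by its finite set of vertices. -/
abbrev ComplexIn (n : ℕ) := Geometry.SimplicialComplex ℝ (Fin n → ℝ)

/-- `F_k(Γ)`, the set of `k`-simplices of `Γ`. -/
def simplices {n : ℕ} (Γ : ComplexIn n) (k : ℕ) : Set (Finset (Fin n → ℝ)) :=
  {σ | σ ∈ Γ.faces ∧ σ.card = k + 1}

/-- `Γ` is a unimodular triangulation of `Δ` with vertices in the lattice: all its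
`n`-simplices have euclidean volume `1 / n!`. -/
structure IsUnimodularTriangulation {n : ℕ} (Γ : ComplexIn n) (Δ : Set (Fin n → ℝ)) : Prop where
  finite : Γ.faces.Finite
  space_eq : Γ.space = Δ
  integral : ∀ v ∈ Γ.vertices, ∃ a : Fin n → ℤ, v = latticePoint a
  unimodular : ∀ σ ∈ simplices Γ n,
    volume (convexHull ℝ (σ : Set (Fin n → ℝ))) = ENNReal.ofReal (1 / (n ! : ℝ))

/-! ### Real phase structures -/

/-- The integral tangent space `T(P) ⊆ ℤⁿ`: the sublattice spanned by the differences of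
two lattice points of `P`. -/
def integralTangent {n : ℕ} (P : Set (Fin n → ℝ)) : AddSubgroup (Fin n → ℤ) :=
  AddSubgroup.closure {w | ∃ a b, latticePoint a ∈ P ∧ latticePoint b ∈ P ∧ w = a - b}

/-- `T₂(P) ⊆ 𝔽₂ⁿ`, the reduction of `T(P)` modulo `2`. -/
def tangentTwo {n : ℕ} (P : Set (Fin n → ℝ)) : Submodule (ZMod 2) (Fin n → ZMod 2) :=
  Submodule.span (ZMod 2) ((fun w i => (w i : ZMod 2)) '' (integralTangent P : Set (Fin n → ℤ)))

/-- The set `𝒬ⁿ` of orthants of `ℝⁿ`, as an affine space over the dual of `𝔽₂ⁿ`: the positive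
orthant is the origin, and `s` is the orthant with `xᵢ < 0` exactly when `s eᵢ = 1`. -/
abbrev Orthant (n : ℕ) := Module.Dual (ZMod 2) (Fin n → ZMod 2)

/-- `T₂^⊥(P)`, the orthogonal of `T₂(P)` in the dual of `𝔽₂ⁿ`. -/
def tangentTwoPerp {n : ℕ} (P : Set (Fin n → ℝ)) : Submodule (ZMod 2) (Orthant n) :=
  (tangentTwo P).dualAnnihilator

/-- A real phase structure on the `k`-skeleton of `Γ`. -/
structure RealPhaseStructure {n : ℕ} (Γ : ComplexIn n) (k : ℕ) where
  phase : simplices Γ k → AffineSubspace (ZMod 2) (Orthant n)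
  nonempty : ∀ σ, (phase σ : Set (Orthant n)).Nonempty
  direction_eq : ∀ σ, (phase σ).direction =
    tangentTwoPerp (convexHull ℝ ((σ : Finset (Fin n → ℝ)) : Set (Fin n → ℝ)))
  parity : ∀ τ ∈ simplices Γ (k + 1), ∀ s : Orthant n,
    Even (Set.ncard {σ : simplices Γ k | (σ : Finset (Fin n → ℝ)) ⊆ τ ∧ s ∈ phase σ})

/-- `ℰ(τ)`, the union of the `ℰ(σ)` over the `k`-faces `σ` of the simplex `τ`. -/
def RealPhaseStructure.orthants {n : ℕ} {Γ : ComplexIn n} {k : ℕ} (E : RealPhaseStructure Γ k)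
    (τ : Finset (Fin n → ℝ)) : Set (Orthant n) :=
  {s | ∃ σ : simplices Γ k, (σ : Finset (Fin n → ℝ)) ⊆ τ ∧ s ∈ E.phase σ}

/-! ### T-manifolds -/

/-- The disjoint union of the symmetric copies `s(Δ)` of `Δ`, one for each orthant `s`. -/
abbrev SymmetricCopies {n : ℕ} (Δ : Set (Fin n → ℝ)) := (_ : Orthant n) × Δ

/-- For each face `F` of `Δ`, the copies `s(F)` and `t(F)` are identified when
`t - s ∈ T₂^⊥(F)`. -/
def Glued {n : ℕ} (Δ : Set (Fin n → ℝ)) (p q : SymmetricCopies Δ) : Prop :=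
  (p.2 : Fin n → ℝ) = q.2 ∧
    ∃ F : Set (Fin n → ℝ), IsExposed ℝ Δ F ∧ (p.2 : Fin n → ℝ) ∈ F ∧
      q.1 - p.1 ∈ tangentTwoPerp F

/-- The space obtained by gluing the symmetric copies of `Δ`, with the quotient topology. -/
abbrev GluedPolytope {n : ℕ} (Δ : Set (Fin n → ℝ)) := Quot (Glued Δ)

/-- The barycenter of a simplex. -/
def barycenter {n : ℕ} (σ : Finset (Fin n → ℝ)) : Fin n → ℝ := σ.centroid ℝ id

/-- The T-manifold of a real phase structure `ℰ`: the union, in the glued polytope, of the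
simplices of the barycentric subdivision all of whose vertices are barycenters of some `s(σ)`
with `s ∈ ℰ(σ)`. A simplex of the barycentric subdivision of the copy `s(Γ)` is the convex hull
of the barycenters of a chain `c` of simplices. -/
def tManifold {n : ℕ} (Δ : Set (Fin n → ℝ)) {Γ : ComplexIn n} {k : ℕ}
    (E : RealPhaseStructure Γ k) : Set (GluedPolytope Δ) :=
  Quot.mk (Glued Δ) '' {p | ∃ c : Finset (Finset (Fin n → ℝ)),
    IsChain (· ⊆ ·) (c : Set (Finset (Fin n → ℝ))) ∧
    (∀ σ ∈ c, σ ∈ Γ.faces ∧ p.1 ∈ E.orthants σ) ∧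
    (p.2 : Fin n → ℝ) ∈ convexHull ℝ (barycenter '' (c : Set (Finset (Fin n → ℝ))))}

/-- `b₀(X)`, the number of connected components of a space. -/
def numComponents (X : Type*) [TopologicalSpace X] : ℕ∞ := ENat.card (ConnectedComponents X)

/-! ### The dual graph -/

/-- The boundary map of the chain complex of a graph with coefficients in `𝔽₂`. -/
def edgeBoundary {V : Type*} (G : SimpleGraph V) :
    (G.edgeSet →₀ ZMod 2) →ₗ[ZMod 2] (V →₀ ZMod 2) :=
  Finsupp.linearCombination (ZMod 2) fun e : G.edgeSet =>
    Sym2.lift ⟨fun a b => Finsupp.single a (1 : ZMod 2) + Finsupp.single b (1 : ZMod 2),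
      fun _ _ => add_comm _ _⟩ (e : Sym2 V)

/-- `b₁(G)`, the dimension of the first homology of a graph with coefficients in `𝔽₂`. -/
def firstBetti {V : Type*} (G : SimpleGraph V) : ℕ :=
  Module.finrank (ZMod 2) (LinearMap.ker (edgeBoundary G))

/-- The `(n-1)`-simplices of `Γ` on the boundary of `Δ`. -/
def boundarySimplices {n : ℕ} (Γ : ComplexIn n) (Δ : Set (Fin n → ℝ)) :
    Set (Finset (Fin n → ℝ)) :=
  {σ | σ ∈ simplices Γ (n - 1) ∧ convexHull ℝ (σ : Set (Fin n → ℝ)) ⊆ frontier Δ}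

/-- Adjacency in the dual graph. Its vertices are the `n`-simplices of `Γ` and the boundary
`(n-1)`-simplices. Two `n`-simplices are joined when they share an `(n-1)`-simplex, and a
boundary `(n-1)`-simplex is joined to the `n`-simplex that contains it. -/
def dualAdj {n : ℕ} (Γ : ComplexIn n) (Δ : Set (Fin n → ℝ)) :
    simplices Γ n ⊕ boundarySimplices Γ Δ → simplices Γ n ⊕ boundarySimplices Γ Δ → Prop
  | .inl τ, .inl τ' => τ ≠ τ' ∧ ∃ σ ∈ simplices Γ (n - 1), σ ⊆ τ.1 ∧ σ ⊆ τ'.1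
  | .inl τ, .inr σ => σ.1 ⊆ τ.1
  | .inr σ, .inl τ => σ.1 ⊆ τ.1
  | .inr _, .inr _ => False

/-- The dual graph `G_Γ` of a triangulation `Γ` of `Δ`. Every edge corresponds to exactly one
`(n-1)`-simplex, since two `n`-simplices share at most one. -/
def dualGraph {n : ℕ} (Γ : ComplexIn n) (Δ : Set (Fin n → ℝ)) :
    SimpleGraph (simplices Γ n ⊕ boundarySimplices Γ Δ) where
  Adj := dualAdj Γ Δ
  symm := ⟨by
    rintro (a | a) (b | b) h
    · exact ⟨h.1.symm, h.2.imp fun _ hσ => ⟨hσ.1, hσ.2.2, hσ.2.1⟩⟩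
    · exact h
    · exact h
    · exact h⟩
  loopless := ⟨by
    rintro (a | a) h
    · exact h.1 rfl
    · exact h⟩

/-- The T-curve of a real phase structure on the `(n-1)`-skeleton of a triangulation `Γ` of `Δ`
is maximal when `b₀(X_ℰ) = b₁(G_Γ) + 1`. -/
def IsMaximalTCurve {n : ℕ} (Δ : Set (Fin n → ℝ)) {Γ : ComplexIn n}
    (E : RealPhaseStructure Γ (n - 1)) : Prop :=
  numComponents (tManifold Δ E) = (firstBetti (dualGraph Γ Δ) : ℕ∞) + 1

/-- Some T-curve with Newton polytope `Δ` is maximal. -/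
def HasMaximalTCurve {n : ℕ} (Δ : Set (Fin n → ℝ)) : Prop :=
  ∃ Γ : ComplexIn n, IsUnimodularTriangulation Γ Δ ∧
    ∃ E : RealPhaseStructure Γ (n - 1), IsMaximalTCurve Δ E

end Patchworking

end

namespace Patchworking

/-! ### Volumes of lattice simplices -/

/-! Let F be a function with values in 𝔽₂ on the components of the T-curve. The phase of an
(n-1)-simplex σ consists of two orthants; let δF(σ) be the sum of the values of F at the two copies
of σ. Then δF is a cycle modulo 2 of the dual graph: the parity condition gives this at each
n-simplex, and δF vanishes on boundary facets because their two copies are glued. Around an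
n-simplex τ, view each facet as an edge joining its two orthants. Unimodularity makes the full set
of facets the only nonempty set whose normals can sum to zero modulo 2, so these edges form a single
Euler circuit (`exists_isTrail_facet`). Hence δF = 0 forces F to be constant around each τ, and then
everywhere, since the n-simplices are connected through facets (`forall_simplices_of_adjacent`).
Thus b₀ ≤ b₁ + 1, and equality requires every cycle to be some δF.

An interior lattice point v₀ produces a cycle that is not of this form. It is a vertex of a
unimodular simplex τ₀. Since n + 1 ≥ 5, there are four facets a, b, c, d of τ₀ through v₀ that occur
in this order on the circuit. The codimension-two faces ρ = a ∩ c and ρ' = b ∩ d contain v₀, so the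
n-simplices around each of them form a cycle. If the cycle around ρ were δF, then F would jump in τ₀
exactly at a and c, and so would differ on b and d. Now sum F over the facets through ρ', simplex by
simplex. Every facet is counted twice, so the total is zero; yet every simplex except τ₀ contributes
zero, because F is constant around it, while τ₀ contributes F(b) + F(d) = 1
(`not_jump_iff_superset`).

The statements on dilations reduce to the first one: a lattice point that is a positive combination,
of total weight at most d, of the vertices of a lattice simplex in Δ, and possibly one more point of
Δ, gives an interior lattice point of d • Δ (`hasInteriorLatticePoint_smul`). Weight n + 1 is always
available, and weight at most n unless Δ is a unimodular simplex. -/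

theorem volume_corner (n : ℕ) (t : ℝ) (ht : 0 ≤ t) :
    volume {x : Fin n → ℝ | (∀ i, 0 ≤ x i) ∧ ∑ i, x i ≤ t} =
      ENNReal.ofReal (t ^ n / (n ! : ℝ)) := by
  induction n generalizing t with
  | zero => simp [ht, volume_pi]
  | succ n ih =>
    have hmeas : MeasurableSet {x : Fin (n + 1) → ℝ | (∀ i, 0 ≤ x i) ∧ ∑ i, x i ≤ t} := by
      refine IsClosed.measurableSet ?_
      have : {x : Fin (n + 1) → ℝ | (∀ i, 0 ≤ x i) ∧ ∑ i, x i ≤ t} =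
          (⋂ i, {x : Fin (n + 1) → ℝ | 0 ≤ x i}) ∩ {x | ∑ i, x i ≤ t} := by ext; simp
      rw [this]
      exact (isClosed_iInter fun i => isClosed_le continuous_const (continuous_apply i)).inter
        (isClosed_le (by fun_prop) continuous_const)
    rw [← (volume_preserving_piFinSuccAbove (fun _ => ℝ) 0).symm.measure_preimage
      hmeas.nullMeasurableSet]
    rw [Measure.volume_eq_prod, Measure.prod_apply
      ((MeasurableEquiv.measurable _) hmeas)]
    -- The slice at first coordinate `u` is the corner of size `t - u` in one dimension less, and is
    -- empty unless 0 ≤ u ≤ t.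
    have key : ∀ u : ℝ, volume (Prod.mk u ⁻¹'
        ((MeasurableEquiv.piFinSuccAbove (fun _ : Fin (n + 1) => ℝ) 0).symm ⁻¹'
          {x : Fin (n + 1) → ℝ | (∀ i, 0 ≤ x i) ∧ ∑ i, x i ≤ t})) =
        (Set.Icc 0 t).indicator (fun u => ENNReal.ofReal ((t - u) ^ n / (n ! : ℝ))) u := by
      intro u
      by_cases hu : u ∈ Set.Icc 0 t
      · rw [Set.indicator_of_mem hu, ← ih (t - u) (by linarith [hu.2])]
        congr 1
        ext x
        simp [Fin.forall_fin_succ, Fin.sum_univ_succ, MeasurableEquiv.piFinSuccAbove, hu.1,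
          Fin.insertNthEquiv, le_sub_iff_add_le']
      · rw [Set.indicator_of_notMem hu]
        refine (congrArg volume (Set.eq_empty_of_forall_notMem fun x => ?_)).trans measure_empty
        simp only [Set.mem_preimage, Set.mem_ofPred_eq]
        simp only [Fin.forall_fin_succ, Fin.sum_univ_succ, MeasurableEquiv.piFinSuccAbove,
          Fin.insertNthEquiv]
        simp
        intro h0 h1
        by_contra hcon
        push Not at hcon
        exact hu ⟨h0, by linarith [Finset.sum_nonneg fun i (_ : i ∈ Finset.univ) => h1 i]⟩
    simp_rw [key]
    rw [lintegral_indicator measurableSet_Icc,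
      ← ofReal_integral_eq_lintegral_ofReal, integral_Icc_eq_integral_Ioc,
      ← intervalIntegral.integral_of_le ht]
    · congr 1
      rw [intervalIntegral.integral_comp_sub_left (fun u => u ^ n / (n ! : ℝ)),
        intervalIntegral.integral_div, integral_pow]
      simp [Nat.factorial_succ]
      field_simp
    · exact (Continuous.integrableOn_Icc (by fun_prop))
    · refine (ae_restrict_iff' measurableSet_Icc).2 (ae_of_all _ fun u hu => ?_)
      have : 0 ≤ t - u := by linarith [hu.2]
      show 0 ≤ (t - u) ^ n / (n ! : ℝ)
      positivity

/-- The matrix of edge vectors at the first vertex of a simplex. -/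
def edgeMatrix {n : ℕ} {R : Type*} [Ring R] (a : Fin (n + 1) → Fin n → R) :
    Matrix (Fin n) (Fin n) R :=
  Matrix.of fun i j => a i.succ j - a 0 j

/-- The simplex is the image of the standard corner under x ↦ b₀ + Aᵀx, with A the edge matrix, so
its volume is scaled by |det A|. -/
theorem volume_convexHull_affineBasis {n : ℕ} (b : AffineBasis (Fin (n + 1)) ℝ (Fin n → ℝ)) :
    volume (convexHull ℝ (Set.range b)) =
      ENNReal.ofReal (|(edgeMatrix b).det| / (n ! : ℝ)) := by
  have himg : convexHull ℝ (Set.range b) = (fun y => b 0 + y) ''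
      ((Matrix.toLin' (edgeMatrix b).transpose) ''
        {x : Fin n → ℝ | (∀ i, 0 ≤ x i) ∧ ∑ i, x i ≤ 1}) := by
    have hexp : ∀ w : Fin (n + 1) → ℝ, ∑ i, w i = 1 →
        ∑ i, w i • b i = b 0 + Matrix.toLin' (edgeMatrix b).transpose (fun i => w i.succ) := by
      intro w hw
      ext j
      rw [Fin.sum_univ_succ] at hw ⊢
      simp only [Pi.add_apply, Finset.sum_apply, Pi.smul_apply, smul_eq_mul, Matrix.toLin'_apply,
        Matrix.mulVec, dotProduct, Matrix.transpose_apply, edgeMatrix, Matrix.of_apply]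
      have : w 0 = 1 - ∑ i : Fin n, w i.succ := by linarith
      rw [this, sub_mul, Finset.sum_mul]
      simp_rw [sub_mul, Finset.sum_sub_distrib, mul_comm (b 0 j)]
      simp_rw [mul_comm]
      ring
    rw [b.convexHull_eq_nonneg_coord]
    ext x
    constructor
    · intro hx
      refine ⟨_, ⟨fun i => b.coord i.succ x, ⟨fun i => hx _, ?_⟩, rfl⟩, ?_⟩
      · have := b.sum_coord_apply_eq_one x
        rw [Fin.sum_univ_succ] at this
        linarith [hx 0]
      · have := hexp (fun i => b.coord i x) (b.sum_coord_apply_eq_one x)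
        rw [b.linear_combination_coord_eq_self] at this
        exact this.symm
    · rintro ⟨_, ⟨y, ⟨hy0, hy1⟩, rfl⟩, rfl⟩
      set w : Fin (n + 1) → ℝ := Fin.cons (1 - ∑ i, y i) y
      have hw : ∑ i, w i = 1 := by simp [w, Fin.sum_univ_succ]
      have := hexp w hw
      simp only [w, Fin.cons_succ] at this
      show _ ∈ {x | ∀ i, 0 ≤ b.coord i x}
      intro i
      dsimp only
      rw [← this, ← Finset.univ.affineCombination_eq_linear_combination _ _ hw,
        b.coord_apply_combination_of_mem (Finset.mem_univ i) hw]
      refine Fin.cases ?_ (fun i => ?_) i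
      · simp only [w, Fin.cons_zero]; linarith
      · simpa only [w, Fin.cons_succ] using hy0 i
  rw [himg, Set.image_add_left, measure_preimage_add, Measure.addHaar_image_linearMap,
    volume_corner n 1 zero_le_one, LinearMap.det_toLin', Matrix.det_transpose,
    ← ENNReal.ofReal_mul (abs_nonneg _)]
  congr 1
  simp [div_eq_mul_inv]

/-! ### Unimodularity and integral barycentric coordinates -/

/-- The linear parts of the barycentric coordinates take integral values on the lattice. -/
def HasIntegralCoords {ι : Type*} {n : ℕ} (b : AffineBasis ι ℝ (Fin n → ℝ)) : Prop :=
  ∀ i, ∀ w : Fin n → ℤ, ∃ m : ℤ, (b.coord i).linear (latticePoint w) = m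

/-- The k-th coordinate changes by δᵢₖ along the edge from b₀ to bᵢ. Integrality of the coordinate
forms thus becomes integrality of an inverse matrix. -/
theorem edgeMatrix_mul_coords {n : ℕ} (b : AffineBasis (Fin (n + 1)) ℝ (Fin n → ℝ)) :
    edgeMatrix b * Matrix.of (fun j k => (b.coord (Fin.succ k)).linear (Pi.single j 1)) = 1 := by
  ext i k
  have h1 : (b.coord k.succ).linear (b i.succ - b 0) = (1 : Matrix (Fin n) (Fin n) ℝ) i k := by
    have := (b.coord k.succ).linearMap_vsub (b i.succ) (b 0)
    rw [vsub_eq_sub, vsub_eq_sub] at this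
    rw [this, b.coord_apply, b.coord_apply, Matrix.one_apply]
    simp [eq_comm]
  rw [← h1, Matrix.mul_apply]
  conv_rhs => rw [LinearMap.pi_apply_eq_sum_univ]
  refine Finset.sum_congr rfl fun j _ => ?_
  simp only [edgeMatrix, Matrix.of_apply, Pi.sub_apply, smul_eq_mul]
  congr 2
  ext l
  simp [Pi.single_apply, eq_comm]

theorem edgeMatrix_latticePoint {n : ℕ} (b : Fin (n + 1) → Fin n → ℝ)
    (a : Fin (n + 1) → Fin n → ℤ) (h : ∀ i, b i = latticePoint (a i)) :
    edgeMatrix b = (edgeMatrix a).map (Int.castRingHom ℝ) := by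
  ext i j
  simp [edgeMatrix, h, latticePoint]

/-- Barycentric coordinates sum to one, so their linear parts sum to zero and the remaining one is
integral too. -/
theorem hasIntegralCoords_of_succ {n : ℕ} (b : AffineBasis (Fin (n + 1)) ℝ (Fin n → ℝ))
    (h : ∀ i : Fin n, ∀ w : Fin n → ℤ, ∃ m : ℤ, (b.coord i.succ).linear (latticePoint w) = m) :
    HasIntegralCoords b := by
  intro i w
  induction i using Fin.cases with
  | succ i => exact h i w
  | zero =>
    choose m hm using fun i => h i w
    refine ⟨-∑ i, m i, ?_⟩
    have hs : ∑ i, (b.coord i).linear (latticePoint w) = 0 := by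
      have : ∀ i, (b.coord i).linear (latticePoint w) =
          b.coord i (latticePoint w) - b.coord i 0 := by
        intro i
        have := (b.coord i).linearMap_vsub (latticePoint w) 0
        simpa using this
      simp_rw [this, Finset.sum_sub_distrib, b.sum_coord_apply_eq_one, sub_self]
    rw [Fin.sum_univ_succ] at hs
    simp_rw [hm] at hs
    push_cast
    linarith

/-- The edge matrix A is integral and the volume is |det A| / n!, so volume 1 / n! means that A is
invertible over ℤ; the entries of its inverse are the values of the coordinate forms on the unit
vectors. -/
theorem volume_eq_iff_hasIntegralCoords_fin {n : ℕ} (b : AffineBasis (Fin (n + 1)) ℝ (Fin n → ℝ))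
    (hb : ∀ i, ∃ a, b i = latticePoint a) :
    volume (convexHull ℝ (Set.range b)) = ENNReal.ofReal (1 / (n ! : ℝ)) ↔
      HasIntegralCoords b := by
  choose a ha using hb
  set A := edgeMatrix a with hA
  have hAM : edgeMatrix b = A.map (Int.castRingHom ℝ) := edgeMatrix_latticePoint b a ha
  have hmul := edgeMatrix_mul_coords b
  rw [hAM] at hmul
  have hdet : (edgeMatrix b).det = (A.det : ℝ) := by
    rw [hAM, ← RingHom.mapMatrix_apply, ← RingHom.map_det]; rfl
  have hunit : volume (convexHull ℝ (Set.range b)) = ENNReal.ofReal (1 / (n ! : ℝ)) ↔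
      IsUnit A.det := by
    rw [volume_convexHull_affineBasis, hdet,
      ENNReal.ofReal_eq_ofReal_iff (by positivity) (by positivity),
      div_left_inj' (by positivity), Int.isUnit_iff_abs_eq]
    norm_cast
  rw [hunit]
  have hlin : ∀ (i : Fin n) (w : Fin n → ℤ), (b.coord i.succ).linear (latticePoint w) =
      ∑ j, (w j : ℝ) * (b.coord i.succ).linear (Pi.single j 1) := by
    intro i w
    rw [LinearMap.pi_apply_eq_sum_univ]
    refine Finset.sum_congr rfl fun j _ => ?_
    simp only [latticePoint, smul_eq_mul]
    congr 2
    ext l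
    simp [Pi.single_apply, eq_comm]
  constructor
  · intro hu
    refine hasIntegralCoords_of_succ b fun i w => ?_
    have hinv : A * A⁻¹ = 1 := Matrix.mul_nonsing_inv A hu
    have hinv' : A⁻¹ * A = 1 := Matrix.nonsing_inv_mul A hu
    have hN : Matrix.of (fun j k => (b.coord (Fin.succ k)).linear (Pi.single j 1)) =
        A⁻¹.map (Int.castRingHom ℝ) := by
      have h2 : A⁻¹.map (Int.castRingHom ℝ) * A.map (Int.castRingHom ℝ) = 1 := by
        rw [← Matrix.map_mul, hinv']; simp
      calc _ = (A⁻¹.map (Int.castRingHom ℝ) * A.map (Int.castRingHom ℝ)) *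
            Matrix.of (fun j k => (b.coord (Fin.succ k)).linear (Pi.single j 1)) := by
              rw [h2, one_mul]
        _ = _ := by rw [mul_assoc, hmul, mul_one]
    refine ⟨∑ j, w j * A⁻¹ j i, ?_⟩
    rw [hlin]
    push_cast
    refine Finset.sum_congr rfl fun j _ => ?_
    have := congrFun (congrFun hN j) i
    simp only [Matrix.of_apply, Matrix.map_apply] at this
    rw [this]
    rfl
  · intro h
    choose N hN using fun (j i : Fin n) => h i.succ (Pi.single j 1)
    have hN' : Matrix.of (fun j k => (b.coord (Fin.succ k)).linear (Pi.single j 1)) =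
        (Matrix.of N).map (Int.castRingHom ℝ) := by
      ext j k
      simp only [Matrix.of_apply, Matrix.map_apply, eq_intCast]
      rw [← hN]
      congr 1
      ext l
      simp [latticePoint, Pi.single_apply]
    rw [hN', ← Matrix.map_mul] at hmul
    have h1 : A * Matrix.of N = 1 := by
      ext i j
      have := congrFun (congrFun hmul i) j
      simp only [Matrix.map_apply, Matrix.one_apply, eq_intCast] at this ⊢
      split_ifs at this ⊢ <;> exact_mod_cast this
    exact IsUnit.of_mul_eq_one _ (by rw [← Matrix.det_mul, h1, Matrix.det_one])

theorem volume_eq_iff_hasIntegralCoords {ι : Type*} [Fintype ι] {n : ℕ}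
    (hι : Fintype.card ι = n + 1) (b : AffineBasis ι ℝ (Fin n → ℝ))
    (hb : ∀ i, ∃ a, b i = latticePoint a) :
    volume (convexHull ℝ (Set.range b)) = ENNReal.ofReal (1 / (n ! : ℝ)) ↔
      HasIntegralCoords b := by
  let e : ι ≃ Fin (n + 1) := Fintype.equivFinOfCardEq hι
  have h := volume_eq_iff_hasIntegralCoords_fin (b.reindex e) (fun i => hb _)
  have hr : Set.range (b.reindex e) = Set.range b := by
    rw [b.coe_reindex, e.symm.surjective.range_comp]
  rw [hr] at h
  rw [h]
  constructor
  · intro h i w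
    simpa using h (e i) w
  · intro h i w
    simpa using h (e.symm i) w

/-- The affine basis formed by the vertices of a full-dimensional simplex. -/
noncomputable def simplexBasis {n : ℕ} (τ : Finset (Fin n → ℝ))
    (hi : AffineIndependent ℝ ((↑) : τ → (Fin n → ℝ))) (hc : τ.card = n + 1) :
    AffineBasis τ ℝ (Fin n → ℝ) :=
  ⟨(↑), hi, by
    rw [hi.affineSpan_eq_top_iff_card_eq_finrank_add_one]
    simp [hc]⟩

@[simp]
theorem simplexBasis_apply {n : ℕ} (τ : Finset (Fin n → ℝ))
    (hi : AffineIndependent ℝ ((↑) : τ → (Fin n → ℝ))) (hc : τ.card = n + 1) (v : τ) :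
    simplexBasis τ hi hc v = v := rfl

theorem range_simplexBasis {n : ℕ} (τ : Finset (Fin n → ℝ))
    (hi : AffineIndependent ℝ ((↑) : τ → (Fin n → ℝ))) (hc : τ.card = n + 1) :
    Set.range (simplexBasis τ hi hc) = τ := by
  ext x; simp

theorem affineBasis_coord_sub_coord {ι : Type*} {n : ℕ} (b : AffineBasis ι ℝ (Fin n → ℝ)) (i : ι)
    (x y : Fin n → ℝ) : b.coord i x - b.coord i y = (b.coord i).linear (x - y) := by
  have := (b.coord i).linearMap_vsub x y
  simpa using this.symm

theorem latticePoint_sub {n : ℕ} (a c : Fin n → ℤ) :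
    latticePoint (a - c) = latticePoint a - latticePoint c := by
  ext i; simp [latticePoint]

theorem latticePoint_add {n : ℕ} (a c : Fin n → ℤ) :
    latticePoint (a + c) = latticePoint a + latticePoint c := by
  ext i; simp [latticePoint]

/-- A lattice point of a unimodular simplex is one of its vertices. -/
theorem HasIntegralCoords.exists_eq_of_mem_convexHull {ι : Type*} [Fintype ι] {n : ℕ}
    {b : AffineBasis ι ℝ (Fin n → ℝ)} (h : HasIntegralCoords b)
    (hb : ∀ i, ∃ a, b i = latticePoint a) {w : Fin n → ℤ}
    (hw : latticePoint w ∈ convexHull ℝ (Set.range b)) : ∃ i, b i = latticePoint w := by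
  rw [b.convexHull_eq_nonneg_coord] at hw
  have hw : ∀ i, 0 ≤ b.coord i (latticePoint w) := hw
  -- The i-th coordinate is 1 at the i-th vertex and changes by an integer from there to w.
  -- Nonnegative integers with sum 1 are then the coordinates of a vertex.
  have hint : ∀ i, ∃ m : ℤ, b.coord i (latticePoint w) = m := by
    intro i
    obtain ⟨a, ha⟩ := hb i
    obtain ⟨m, hm⟩ := h i (w - a)
    refine ⟨m + 1, ?_⟩
    rw [latticePoint_sub, ← ha, ← affineBasis_coord_sub_coord, b.coord_apply_eq] at hm
    push_cast
    linarith
  choose m hm using hint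
  have hsum : ∑ i, m i = 1 := by
    have := b.sum_coord_apply_eq_one (latticePoint w)
    simp_rw [hm] at this
    exact_mod_cast this
  have hm0 : ∀ i, 0 ≤ m i := fun i => by have := hw i; rw [hm] at this; exact_mod_cast this
  obtain ⟨i, hi⟩ : ∃ i, 0 < m i := by
    by_contra! hcon
    have : ∑ i, m i ≤ 0 := Finset.sum_nonpos fun i _ => hcon i
    omega
  refine ⟨i, b.ext_elem fun j => ?_⟩
  classical
  rw [b.coord_apply, hm]
  have hle := Finset.add_sum_erase Finset.univ m (Finset.mem_univ i)
  split_ifs with hij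
  · subst hij
    have : 0 ≤ ∑ x ∈ Finset.univ.erase j, m x := Finset.sum_nonneg fun x _ => hm0 x
    have : m j = 1 := by omega
    rw [this]; simp
  · have h1 : m j ≤ ∑ x ∈ Finset.univ.erase i, m x :=
      Finset.single_le_sum (fun x _ => hm0 x) (Finset.mem_erase.2 ⟨hij, Finset.mem_univ j⟩)
    have : m j = 0 := by have := hm0 j; omega
    rw [this]; simp

/-! ### Normals modulo two -/

/-- Reduction modulo two of lattice vectors. -/
def reduction (n : ℕ) : (Fin n → ℤ) →+ (Fin n → ZMod 2) where
  toFun w i := (w i : ZMod 2)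
  map_zero' := by ext; simp
  map_add' x y := by ext; simp

theorem reduction_surjective (n : ℕ) : Function.Surjective (reduction n) := fun x =>
  ⟨fun i => (ZMod.cast (x i) : ℤ), by ext i; simp [reduction]⟩

theorem mem_tangentTwoPerp_iff {n : ℕ} {P : Set (Fin n → ℝ)} {β : Orthant n} :
    β ∈ tangentTwoPerp P ↔
      ∀ a c, latticePoint a ∈ P → latticePoint c ∈ P → β (reduction n (a - c)) = 0 := by
  rw [tangentTwoPerp, Submodule.mem_dualAnnihilator]
  constructor
  · intro h a c ha hc
    exact h _ (Submodule.subset_span ⟨a - c, AddSubgroup.subset_closure ⟨a, c, ha, hc, rfl⟩, rfl⟩)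
  · intro h w hw
    have hle : tangentTwo P ≤ LinearMap.ker β := by
      refine Submodule.span_le.2 ?_
      rintro _ ⟨w, hw, rfl⟩
      have hle' : integralTangent P ≤ (β.toAddMonoidHom.comp (reduction n)).ker := by
        refine (AddSubgroup.closure_le _).2 ?_
        rintro _ ⟨a, c, ha, hc, rfl⟩
        exact h a c ha hc
      exact hle' hw
    exact hle hw

section Normal

variable {ι : Type*} {n : ℕ} {b : AffineBasis ι ℝ (Fin n → ℝ)}

/-- The linear part of a barycentric coordinate, reduced modulo two. -/
noncomputable def HasIntegralCoords.normal (h : HasIntegralCoords b) (i : ι) : Orthant n :=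
  ∑ j, (((h i (Pi.single j 1)).choose : ℤ) : ZMod 2) • LinearMap.proj j

/-- The integers chosen in `normal` are the values on the unit vectors, so by linearity they give
the values on all lattice vectors. -/
theorem HasIntegralCoords.normal_reduction (h : HasIntegralCoords b) (i : ι) {w : Fin n → ℤ}
    {m : ℤ} (hm : (b.coord i).linear (latticePoint w) = m) :
    h.normal i (reduction n w) = (m : ZMod 2) := by
  have hspec := fun j => (h i (Pi.single j 1)).choose_spec
  have hlin : (b.coord i).linear (latticePoint w) =
      ∑ j, (w j : ℝ) * (b.coord i).linear (latticePoint (Pi.single j 1)) := by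
    rw [LinearMap.pi_apply_eq_sum_univ]
    refine Finset.sum_congr rfl fun j _ => ?_
    have : (latticePoint (Pi.single j 1) : Fin n → ℝ) = fun l => if j = l then 1 else 0 := by
      ext l
      by_cases hl : j = l
      · subst hl; simp [latticePoint]
      · simp [latticePoint, hl, Ne.symm hl]
    rw [this]
    rfl
  rw [Finset.sum_congr rfl fun j _ => congrArg ((w j : ℝ) * ·) (hspec j), hm] at hlin
  have hm' : m = ∑ j, w j * (h i (Pi.single j 1)).choose := by exact_mod_cast hlin
  conv_rhs => rw [hm']
  rw [HasIntegralCoords.normal, LinearMap.sum_apply]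
  push_cast
  refine Finset.sum_congr rfl fun j _ => ?_
  rw [LinearMap.smul_apply, LinearMap.proj_apply, smul_eq_mul, mul_comm]
  rfl

variable [DecidableEq ι]

theorem HasIntegralCoords.normal_edge (h : HasIntegralCoords b) (i j k : ι) {a c : Fin n → ℤ}
    (ha : b j = latticePoint a) (hc : b k = latticePoint c) :
    h.normal i (reduction n (a - c)) =
      (if i = j then 1 else 0) - (if i = k then 1 else 0) := by
  rw [h.normal_reduction i
    (m := (if i = j then 1 else 0) - (if i = k then 1 else 0))]
  · push_cast; rfl
  · rw [latticePoint_sub, ← ha, ← hc, ← affineBasis_coord_sub_coord, b.coord_apply, b.coord_apply]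
    push_cast; rfl

/-- If S contains i but not j, the sum takes the value 1 on the edge vector from j to i. This
minimality yields the Euler circuits. -/
theorem HasIntegralCoords.sum_normal_eq_zero [Fintype ι] (h : HasIntegralCoords b)
    (hb : ∀ i, ∃ a, b i = latticePoint a) {S : Finset ι} (hS : ∑ i ∈ S, h.normal i = 0) :
    S = ∅ ∨ S = Finset.univ := by
  by_contra! hcon
  obtain ⟨i, hi⟩ := hcon.1
  obtain ⟨j, hj⟩ : ∃ j, j ∉ S := by
    by_contra! hall
    exact hcon.2 (Finset.eq_univ_iff_forall.2 hall)
  obtain ⟨a, ha⟩ := hb i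
  obtain ⟨c, hc⟩ := hb j
  have := LinearMap.congr_fun hS (reduction n (a - c))
  rw [LinearMap.sum_apply] at this
  simp_rw [h.normal_edge _ i j ha hc, Finset.sum_sub_distrib] at this
  simp [hi, hj] at this

omit [DecidableEq ι] in
-- The edge vectors at any vertex k generate ℤⁿ. Since the coefficients sum to zero, the base vertex
-- can be subtracted from every term.
theorem HasIntegralCoords.exists_sum_eq [Fintype ι] (h : HasIntegralCoords b)
    {a : ι → Fin n → ℤ} (ha : ∀ i, b i = latticePoint (a i)) (k : ι) (w : Fin n → ℤ) :
    ∃ m : ι → ℤ, (∀ i, (b.coord i).linear (latticePoint w) = m i) ∧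
      w = ∑ i, m i • (a i - a k) := by
  choose m hm using fun i => h i w
  refine ⟨m, hm, ?_⟩
  have hsum : ∑ i, m i = 0 := by
    have h0 : ∑ i, (b.coord i).linear (latticePoint w) = 0 := by
      have : ∀ i, (b.coord i).linear (latticePoint w) =
          b.coord i (latticePoint w) - b.coord i 0 := by
        intro i
        rw [affineBasis_coord_sub_coord, sub_zero]
      simp_rw [this, Finset.sum_sub_distrib, b.sum_coord_apply_eq_one, sub_self]
    simp_rw [hm] at h0
    exact_mod_cast h0
  have hw : latticePoint w = ∑ i, (m i : ℝ) • b i := by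
    have h1 := b.linear_combination_coord_eq_self (latticePoint w)
    have h2 := b.linear_combination_coord_eq_self 0
    have : ∀ i, (m i : ℝ) = b.coord i (latticePoint w) - b.coord i 0 := by
      intro i
      rw [affineBasis_coord_sub_coord, sub_zero, hm]
    simp_rw [this, sub_smul, Finset.sum_sub_distrib]
    rw [h1, h2, sub_zero]
  ext j
  have hj := congrFun hw j
  simp only [latticePoint, Finset.sum_apply, Pi.smul_apply, ha, smul_eq_mul] at hj
  simp only [Finset.sum_apply, Pi.smul_apply, Pi.sub_apply, smul_eq_mul, mul_sub,
    Finset.sum_sub_distrib]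
  rw [← Finset.sum_mul, hsum, zero_mul, sub_zero]
  exact_mod_cast hj

omit [DecidableEq ι] in
/-- The normal of a facet lies in `T₂^⊥` of any set of points on the hyperplane of the facet. -/
theorem HasIntegralCoords.normal_mem_tangentTwoPerp (h : HasIntegralCoords b) (i : ι)
    {P : Set (Fin n → ℝ)} (hP : ∀ x ∈ P, b.coord i x = 0) : h.normal i ∈ tangentTwoPerp P := by
  rw [mem_tangentTwoPerp_iff]
  intro a c ha hc
  rw [h.normal_reduction i (m := 0)]
  · simp
  · rw [latticePoint_sub, ← affineBasis_coord_sub_coord, hP _ ha, hP _ hc]; simp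

omit [DecidableEq ι] in
-- A form that vanishes along the facet is determined by its value on the one edge from k that
-- leaves the facet, which is 0 or 1.
theorem HasIntegralCoords.mem_tangentTwoPerp_facet [Fintype ι] (h : HasIntegralCoords b)
    (hb : ∀ i, ∃ a, b i = latticePoint a) {i k : ι} (hk : k ≠ i) {β : Orthant n} :
    β ∈ tangentTwoPerp (convexHull ℝ (b '' {i}ᶜ)) ↔ β = 0 ∨ β = h.normal i := by
  constructor
  · intro hβ
    rw [mem_tangentTwoPerp_iff] at hβ
    choose a ha using hb
    have hmem : ∀ j, j ≠ i → latticePoint (a j) ∈ convexHull ℝ (b '' {i}ᶜ) := fun j hj =>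
      subset_convexHull ℝ _ ⟨j, hj, ha j⟩
    set c : ZMod 2 := β (reduction n (a i - a k)) with hc
    have hβ' : β = c • h.normal i := by
      refine LinearMap.ext fun w => ?_
      obtain ⟨w, rfl⟩ := reduction_surjective n w
      obtain ⟨m, hm, hw⟩ := h.exists_sum_eq ha k w
      rw [LinearMap.smul_apply, h.normal_reduction i (hm i)]
      conv_lhs => rw [hw]
      rw [map_sum, map_sum, Finset.sum_eq_single i]
      · rw [map_zsmul, map_zsmul, ← hc, zsmul_eq_mul, smul_eq_mul, mul_comm]
      · intro j _ hj
        rw [map_zsmul, map_zsmul, hβ _ _ (hmem j hj) (hmem k hk), smul_zero]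
      · simp
    have h01 : ∀ c : ZMod 2, c = 0 ∨ c = 1 := by decide
    rcases h01 c with h0 | h0 <;> rw [h0] at hβ' <;> simp [hβ']
  · rintro (rfl | rfl)
    · exact Submodule.zero_mem _
    · refine h.normal_mem_tangentTwoPerp i fun x hx => ?_
      have hsub : convexHull ℝ (b '' {i}ᶜ) ⊆ {x | b.coord i x = 0} := by
        refine convexHull_min ?_ ?_
        · rintro _ ⟨j, hj, rfl⟩
          exact b.coord_apply_ne (Ne.symm hj)
        · exact (convex_singleton (0 : ℝ)).affine_preimage (b.coord i)
      exact hsub hx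

end Normal

/-! ### Euler circuits -/

section Euler

variable {L V : Type*} {p q : L → V}

/-- A trail of length `m` in the multigraph with edges `{p i, q i}`. -/
def IsTrail (p q : L → V) (m : ℕ) (s : ℕ → V) (e : ℕ → L) : Prop :=
  Set.InjOn e (Set.Iio m) ∧
    ∀ k < m, (s k = p (e k) ∧ s (k + 1) = q (e k)) ∨ (s k = q (e k) ∧ s (k + 1) = p (e k))

/-- The boundary of an edge with coefficients in `𝔽₂`. -/
noncomputable def ends (p q : L → V) (i : L) : V →₀ ZMod 2 :=
  Finsupp.single (p i) 1 + Finsupp.single (q i) 1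

/-- Inner vertices of the trail cancel modulo two. In particular a closed trail uses an even set of
edges. -/
theorem IsTrail.sum_ends [DecidableEq L] {m : ℕ} {s : ℕ → V} {e : ℕ → L}
    (h : IsTrail p q m s e) :
    ∑ i ∈ (Finset.range m).image e, ends p q i =
      Finsupp.single (s 0) 1 + Finsupp.single (s m) 1 := by
  rw [Finset.sum_image (by simpa [Set.InjOn] using h.1)]
  have h2 : ∀ x : V →₀ ZMod 2, x + x = 0 := ZModModule.add_self
  suffices ∀ k ≤ m, ∑ i ∈ Finset.range k, ends p q (e i) =
      Finsupp.single (s 0) 1 + Finsupp.single (s k) 1 from this m le_rfl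
  intro k
  induction k with
  | zero => intro _; simp [h2]
  | succ k ih =>
    intro hk
    rw [Finset.sum_range_succ, ih (by omega)]
    have hends : ends p q (e k) = Finsupp.single (s k) 1 + Finsupp.single (s (k + 1)) 1 := by
      rcases h.2 k (by omega) with ⟨h1, h2⟩ | ⟨h1, h2⟩ <;> rw [h1, h2, ends]
      rw [add_comm]
    rw [hends, add_assoc, ← add_assoc (Finsupp.single (s k) 1), h2, zero_add]

theorem IsTrail.apply_eq {m : ℕ} {s : ℕ → V} {e : ℕ → L} (h : IsTrail p q m s e)
    (f : V → ZMod 2) {k : ℕ} (hk : k ≤ m) :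
    f (s k) = f (s 0) + ∑ j ∈ Finset.range k, (f (p (e j)) + f (q (e j))) := by
  induction k with
  | zero => simp
  | succ k ih =>
    rw [Finset.sum_range_succ, ← add_assoc, ← ih (by omega)]
    rcases h.2 k (by omega) with ⟨h1, h2⟩ | ⟨h1, h2⟩ <;> rw [h1, h2]
    · rw [← add_assoc, CharTwo.add_self_eq_zero, zero_add]
    · rw [add_comm (f (p (e k))), ← add_assoc, CharTwo.add_self_eq_zero, zero_add]

/-- If the whole edge set is the only nonempty set of edges with even degrees, then the graph
has an Euler circuit. -/
theorem exists_isTrail_card [Fintype L] [Nonempty L]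
    (hpar : ∑ i, ends p q i = 0)
    (hmin : ∀ S : Finset L, ∑ i ∈ S, ends p q i = 0 → S = ∅ ∨ S = Finset.univ) :
    ∃ s e, IsTrail p q (Fintype.card L) s e := by
  classical
  -- Trails are extended one edge at a time. That the final trail is closed is not recorded: later
  -- arguments use only the order of its edges.
  suffices ∀ m, m + 1 ≤ Fintype.card L → ∃ s e, IsTrail p q (m + 1) s e by
    have hpos : 0 < Fintype.card L := Fintype.card_pos
    obtain ⟨s, e, h⟩ := this (Fintype.card L - 1) (by omega)
    rw [Nat.sub_add_cancel hpos] at h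
    exact ⟨s, e, h⟩
  intro m
  induction m with
  | zero =>
    intro _
    let i : L := Classical.arbitrary L
    refine ⟨fun k => if k = 0 then p i else q i, fun _ => i, ?_, fun k hk => Or.inl ?_⟩
    · intro x hx y hy _
      simp only [Set.mem_Iio] at hx hy
      omega
    · have : k = 0 := by omega
      simp [this]
  | succ m ih =>
    intro hm
    obtain ⟨s, e, h⟩ := ih (by omega)
    set S := (Finset.range (m + 1)).image e with hS
    have hcard : S.card = m + 1 := by
      rw [hS, Finset.card_image_of_injOn (by simpa using h.1), Finset.card_range]
    -- The edges used so far are a nonempty proper subset, hence not even, so the trail is not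
    -- closed.
    have hne : ∑ i ∈ S, ends p q i ≠ 0 := by
      intro h0
      rcases hmin S h0 with h1 | h1
      · rw [h1] at hcard; simp at hcard
      · rw [h1, Finset.card_univ] at hcard; omega
    have hsum := h.sum_ends
    rw [← hS] at hsum
    have hst : s 0 ≠ s (m + 1) := by
      intro heq
      rw [hsum, heq, ZModModule.add_self] at hne
      exact hne rfl
    -- All degrees in the whole graph are even, so the unused edges have odd degree at the endpoint,
    -- and one of them extends the trail.
    have hval : (∑ i ∈ Sᶜ, ends p q i) (s (m + 1)) ≠ 0 := by
      have h0 := Finset.sum_add_sum_compl S (ends p q)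
      rw [hpar] at h0
      have h1 := DFunLike.congr_fun h0 (s (m + 1))
      rw [hsum] at h1
      simp [hst] at h1
      intro h2
      rw [Finsupp.finsetSum_apply] at h2
      rw [h2] at h1
      simp at h1
    obtain ⟨i, hi, hv⟩ : ∃ i ∈ Sᶜ, s (m + 1) = p i ∨ s (m + 1) = q i := by
      by_contra! hcon
      apply hval
      rw [Finsupp.finsetSum_apply]
      refine Finset.sum_eq_zero fun i hi => ?_
      obtain ⟨h1, h2⟩ := hcon i hi
      simp [ends, h1.symm, h2.symm]
    have hi' : ∀ k, k < m + 1 → e k ≠ i := by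
      intro k hk heq
      rw [Finset.mem_compl, hS, Finset.mem_image] at hi
      exact hi ⟨k, Finset.mem_range.2 hk, heq⟩
    refine ⟨Function.update s (m + 2) (if s (m + 1) = p i then q i else p i),
      Function.update e (m + 1) i, ?_, ?_⟩
    · intro x hx y hy hxy
      simp only [Set.mem_Iio] at hx hy
      by_cases hx1 : x = m + 1 <;> by_cases hy1 : y = m + 1
      · omega
      · rw [hx1, Function.update_self, Function.update_of_ne hy1] at hxy
        exact absurd hxy.symm (hi' y (by omega))
      · rw [hy1, Function.update_self, Function.update_of_ne hx1] at hxy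
        exact absurd hxy (hi' x (by omega))
      · rw [Function.update_of_ne hx1, Function.update_of_ne hy1] at hxy
        exact h.1 (Set.mem_Iio.2 (by omega)) (Set.mem_Iio.2 (by omega)) hxy
    · intro k hk
      by_cases hk1 : k = m + 1
      · subst hk1
        rw [Function.update_self, Function.update_self, Function.update_of_ne (by omega)]
        split_ifs with h1
        · exact Or.inl ⟨h1, rfl⟩
        · exact Or.inr ⟨hv.resolve_left h1, rfl⟩
      · rw [Function.update_of_ne hk1, Function.update_of_ne (by omega : k ≠ m + 2),
          Function.update_of_ne (by omega : k + 1 ≠ m + 2)]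
        exact h.2 k (by omega)

/-- A function on the vertices of an Euler circuit that jumps nowhere is constant. -/
theorem IsTrail.const_of_no_jump [Fintype L] {s : ℕ → V} {e : ℕ → L}
    (h : IsTrail p q (Fintype.card L) s e) (f : V → ZMod 2) (hf : ∀ i, f (p i) = f (q i))
    (i j : L) : f (p i) = f (p j) := by
  classical
  have hall : ∀ i, f (p i) = f (s 0) := by
    intro i
    -- A trail as long as the number of edges passes through every edge.
    have himg : (Finset.range (Fintype.card L)).image e = Finset.univ := by
      apply Finset.eq_univ_of_card
      rw [Finset.card_image_of_injOn (by simpa using h.1), Finset.card_range]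
    obtain ⟨k, hk, rfl⟩ := Finset.mem_image.1 (himg ▸ Finset.mem_univ i)
    rw [Finset.mem_range] at hk
    have h0 := h.apply_eq f hk.le
    simp_rw [hf, CharTwo.add_self_eq_zero] at h0
    rw [Finset.sum_const_zero, add_zero] at h0
    rw [← h0]
    rcases h.2 k hk with ⟨h1, _⟩ | ⟨h1, _⟩ <;> rw [h1]
    exact hf _
  rw [hall i, hall j]

/-- On an Euler circuit with at least five edges, any edge can be avoided by two interlaced pairs
of edges: a function that jumps exactly on the first pair separates the second pair. -/
theorem IsTrail.exists_interlaced [Fintype L] {s : ℕ → V} {e : ℕ → L}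
    (h : IsTrail p q (Fintype.card L) s e) (hL : 5 ≤ Fintype.card L) (v : L) :
    ∃ a b c d : L, a ≠ v ∧ b ≠ v ∧ c ≠ v ∧ d ≠ v ∧ a ≠ b ∧ a ≠ c ∧ a ≠ d ∧ b ≠ c ∧ b ≠ d ∧ c ≠ d ∧
      ∀ f : V → ZMod 2, (∀ i, f (p i) ≠ f (q i) ↔ i = a ∨ i = c) →
        f (p b) ≠ f (p d) := by
  classical
  -- At most one of the first five edges is `v`; the other four, in the order of the trail, are the
  -- required ones.
  obtain ⟨k₁, k₂, k₃, k₄, h12, h23, h34, h4, hv1, hv2, hv3, hv4⟩ :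
      ∃ k₁ k₂ k₃ k₄ : ℕ, k₁ < k₂ ∧ k₂ < k₃ ∧ k₃ < k₄ ∧ k₄ < Fintype.card L ∧
        e k₁ ≠ v ∧ e k₂ ≠ v ∧ e k₃ ≠ v ∧ e k₄ ≠ v := by
    have hinj : ∀ i j, i < 5 → j < 5 → e i = v → e j = v → i = j := fun i j hi hj h1 h2 =>
      h.1 (Set.mem_Iio.2 (by omega)) (Set.mem_Iio.2 (by omega)) (h1.trans h2.symm)
    by_cases h0 : e 0 = v
    · exact ⟨1, 2, 3, 4, by omega, by omega, by omega, by omega,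
        fun h' => by have := hinj 0 1 (by omega) (by omega) h0 h'; omega,
        fun h' => by have := hinj 0 2 (by omega) (by omega) h0 h'; omega,
        fun h' => by have := hinj 0 3 (by omega) (by omega) h0 h'; omega,
        fun h' => by have := hinj 0 4 (by omega) (by omega) h0 h'; omega⟩
    by_cases h1 : e 1 = v
    · exact ⟨0, 2, 3, 4, by omega, by omega, by omega, by omega, h0,
        fun h' => by have := hinj 1 2 (by omega) (by omega) h1 h'; omega,
        fun h' => by have := hinj 1 3 (by omega) (by omega) h1 h'; omega,
        fun h' => by have := hinj 1 4 (by omega) (by omega) h1 h'; omega⟩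
    by_cases h2 : e 2 = v
    · exact ⟨0, 1, 3, 4, by omega, by omega, by omega, by omega, h0, h1,
        fun h' => by have := hinj 2 3 (by omega) (by omega) h2 h'; omega,
        fun h' => by have := hinj 2 4 (by omega) (by omega) h2 h'; omega⟩
    by_cases h3 : e 3 = v
    · exact ⟨0, 1, 2, 4, by omega, by omega, by omega, by omega, h0, h1, h2,
        fun h' => by have := hinj 3 4 (by omega) (by omega) h3 h'; omega⟩
    · exact ⟨0, 1, 2, 3, by omega, by omega, by omega, by omega, h0, h1, h2, h3⟩
  have hne : ∀ i j, i < j → j < Fintype.card L → e i ≠ e j := fun i j hi hj heq => by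
    have := h.1 (Set.mem_Iio.2 (hi.trans hj)) (Set.mem_Iio.2 hj) heq
    omega
  refine ⟨e k₁, e k₂, e k₃, e k₄, hv1, hv2, hv3, hv4, hne _ _ h12 (by omega),
    hne _ _ (by omega) (by omega), hne _ _ (by omega) (by omega), hne _ _ (by omega) (by omega),
    hne _ _ (by omega) (by omega), hne _ _ (by omega) (by omega), fun f hf => ?_⟩
  have h01 : ∀ x y : ZMod 2, x ≠ y → x + y = 1 := by decide
  have hjump : ∀ i, f (p i) + f (q i) = if i = e k₁ ∨ i = e k₃ then 1 else 0 := by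
    intro i
    split_ifs with hi
    · exact h01 _ _ ((hf i).2 hi)
    · have := (not_congr (hf i)).2 hi
      rw [not_not] at this
      rw [this, CharTwo.add_self_eq_zero]
  -- Off the two jumping edges both ends have the same value, so the direction in which the trail
  -- runs through an edge is irrelevant.
  have hsk : ∀ k, k < Fintype.card L → k ≠ k₁ → k ≠ k₃ → f (p (e k)) = f (s k) := by
    intro k hk hk1 hk3
    have hne' : ∀ j < Fintype.card L, k ≠ j → e k ≠ e j := fun j hj hkj heq =>
      hkj (h.1 (Set.mem_Iio.2 hk) (Set.mem_Iio.2 hj) heq)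
    rcases h.2 k hk with ⟨h1, _⟩ | ⟨h1, _⟩ <;> rw [h1]
    have := (not_congr (hf (e k))).2 (by
      rintro (h' | h')
      · exact hne' _ (by omega) hk1 h'
      · exact hne' _ (by omega) hk3 h')
    exact not_not.1 this
  rw [hsk k₂ (by omega) (by omega) (by omega), hsk k₄ (by omega) (by omega) (by omega),
    h.apply_eq f (by omega : k₂ ≤ _), h.apply_eq f h4.le]
  simp_rw [hjump]
  have hiff : ∀ j < Fintype.card L, (e j = e k₁ ∨ e j = e k₃) ↔ (j = k₁ ∨ j = k₃) := by
    intro j hj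
    constructor
    · rintro (h' | h')
      · exact Or.inl (h.1 (Set.mem_Iio.2 hj) (Set.mem_Iio.2 (by omega)) h')
      · exact Or.inr (h.1 (Set.mem_Iio.2 hj) (Set.mem_Iio.2 (by omega)) h')
    · rintro (rfl | rfl) <;> simp
  -- One jump occurs before position `k₂` and two before `k₄`, so the values there differ.
  have hs2 : ∑ j ∈ Finset.range k₂, (if e j = e k₁ ∨ e j = e k₃ then (1 : ZMod 2) else 0) = 1 := by
    rw [Finset.sum_eq_single k₁]
    · simp
    · intro j hj hj1
      rw [Finset.mem_range] at hj
      rw [if_neg]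
      rw [hiff j (by omega)]
      omega
    · intro hj
      rw [Finset.mem_range] at hj
      omega
  have hs4 : ∑ j ∈ Finset.range k₄, (if e j = e k₁ ∨ e j = e k₃ then (1 : ZMod 2) else 0) = 0 := by
    rw [Finset.sum_eq_add_of_mem k₁ k₃ (Finset.mem_range.2 (by omega))
      (Finset.mem_range.2 (by omega)) (by omega)]
    · simp; decide
    · intro j hj hj1
      rw [Finset.mem_range] at hj
      rw [if_neg]
      rw [hiff j (by omega)]
      omega
  rw [hs2, hs4]
  generalize f (s 0) = x
  revert x
  decide

end Euler

/-! ### Geometry of triangulations -/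

section Barycenter

variable {n : ℕ}

theorem barycenter_mem_convexHull {σ : Finset (Fin n → ℝ)} (hσ : σ.Nonempty) :
    barycenter σ ∈ convexHull ℝ (σ : Set (Fin n → ℝ)) :=
  σ.centroid_mem_convexHull hσ

theorem map_barycenter {σ : Finset (Fin n → ℝ)} (hσ : σ.Nonempty) (g : (Fin n → ℝ) →ᵃ[ℝ] ℝ) :
    g (barycenter σ) = (σ.card : ℝ)⁻¹ * ∑ v ∈ σ, g v := by
  have hw := σ.sum_centroidWeights_eq_one_of_nonempty ℝ hσ
  rw [barycenter, Finset.centroid_def, Finset.map_affineCombination _ _ _ hw,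
    Finset.affineCombination_eq_linear_combination _ _ _ hw, Finset.mul_sum]
  simp [Finset.centroidWeights_apply]

theorem volume_affineSpan_eq_zero {ρ : Finset (Fin n → ℝ)} (hρ : ρ.card ≤ n) :
    volume (affineSpan ℝ (ρ : Set (Fin n → ℝ)) : Set (Fin n → ℝ)) = 0 := by
  refine Measure.addHaar_affineSubspace volume _ fun htop => ?_
  rcases ρ.eq_empty_or_nonempty with rfl | hne
  · simp only [Finset.coe_empty, AffineSubspace.span_empty] at htop
    exact AffineSubspace.bot_ne_top ℝ (Fin n → ℝ) (Fin n → ℝ) htop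
  · have h1 : Module.finrank ℝ (vectorSpan ℝ (Set.range ((↑) : ρ → (Fin n → ℝ)))) ≤ ρ.card - 1 :=
      finrank_vectorSpan_range_le ℝ _ (by
        rw [Fintype.card_coe]; have := hne.card_pos; omega)
    have h2 : vectorSpan ℝ (Set.range ((↑) : ρ → (Fin n → ℝ))) = ⊤ := by
      rw [← direction_affineSpan]
      simp [htop]
    rw [h2, finrank_top, Module.finrank_fin_fun] at h1
    have := hne.card_pos
    omega

end Barycenter

section Triangulation

variable {n : ℕ} {Γ : ComplexIn n} {Δ : Set (Fin n → ℝ)}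

theorem card_le_of_mem_faces {σ : Finset (Fin n → ℝ)} (hσ : σ ∈ Γ.faces) : σ.card ≤ n + 1 := by
  have := (Γ.indep hσ).card_le_finrank_succ
  rw [Fintype.card_coe] at this
  refine this.trans (Nat.succ_le_succ ((Submodule.finrank_le _).trans ?_))
  simp

/-- A simplex contains the barycenter of another one only if the latter is one of its faces. -/
theorem subset_of_barycenter_mem {σ τ : Finset (Fin n → ℝ)} (hσ : σ ∈ Γ.faces) (hτ : τ ∈ Γ.faces)
    (h : barycenter σ ∈ convexHull ℝ (τ : Set (Fin n → ℝ))) : σ ⊆ τ := by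
  intro v hv
  by_contra hvτ
  have hne : σ.Nonempty := ⟨v, hv⟩
  -- The barycenter would lie in the span of the common vertices, although its weight at `v` is
  -- nonzero.
  have h1 := Γ.inter_subset_convexHull hσ hτ ⟨barycenter_mem_convexHull hne, h⟩
  have h2 : barycenter σ ∈ affineSpan ℝ (((↑) : σ → (Fin n → ℝ)) '' {u | (u : Fin n → ℝ) ∈ τ}) := by
    refine affineSpan_mono ℝ ?_ (convexHull_subset_affineSpan _ h1)
    rintro x ⟨hx1, hx2⟩
    exact ⟨⟨x, hx1⟩, hx2, rfl⟩
  rw [barycenter, ← Finset.centroid_univ, Finset.centroid_def] at h2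
  have hne' : (Finset.univ : Finset σ).Nonempty := ⟨⟨v, hv⟩, Finset.mem_univ _⟩
  have h3 := (Γ.indep hσ).eq_zero_of_affineCombination_mem_affineSpan
    (Finset.univ.sum_centroidWeights_eq_one_of_nonempty ℝ hne') h2
    (Finset.mem_univ ⟨v, hv⟩) hvτ
  rw [Finset.centroidWeights_apply, inv_eq_zero, Nat.cast_eq_zero] at h3
  exact hne'.card_pos.ne' h3

/-- The maximal simplices cover the polytope. -/
theorem exists_simplex_mem (h : IsUnimodularTriangulation Γ Δ) (hΔ : Convex ℝ Δ)
    (hne : (interior Δ).Nonempty) {x : Fin n → ℝ} (hx : x ∈ Δ) :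
    ∃ τ ∈ simplices Γ n, x ∈ convexHull ℝ (τ : Set (Fin n → ℝ)) := by
  have hfin : (simplices Γ n).Finite := h.finite.subset fun _ hσ => hσ.1
  set U : Set (Fin n → ℝ) := ⋃ τ ∈ simplices Γ n, convexHull ℝ (τ : Set (Fin n → ℝ)) with hU
  have hUc : IsClosed U := hfin.isClosed_biUnion fun τ _ =>
    τ.finite_toSet.isClosed_convexHull ℝ
  set N : Set (Fin n → ℝ) := ⋃ σ ∈ {σ ∈ Γ.faces | σ.card ≤ n},
    (affineSpan ℝ (σ : Set (Fin n → ℝ)) : Set (Fin n → ℝ)) with hN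
  have hN0 : volume N = 0 := by
    refine (measure_biUnion_null_iff (h.finite.subset fun _ hσ => hσ.1).countable).2 ?_
    exact fun σ hσ => volume_affineSpan_eq_zero hσ.2
  have hcov : Δ ⊆ U ∪ N := by
    intro y hy
    rw [← h.space_eq, Geometry.SimplicialComplex.mem_space_iff] at hy
    obtain ⟨σ, hσ, hyσ⟩ := hy
    rcases Nat.lt_or_ge n σ.card with hc | hc
    · exact Or.inl (Set.mem_biUnion (⟨hσ, by have := card_le_of_mem_faces hσ; omega⟩ :
        σ ∈ simplices Γ n) hyσ)
    · exact Or.inr (Set.mem_biUnion (⟨hσ, hc⟩ : σ ∈ {σ ∈ Γ.faces | σ.card ≤ n})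
        (convexHull_subset_affineSpan _ hyσ))
  -- The part of the interior outside the closed set `U` is open and lies in the null set `N`, so it
  -- is empty. The interior is dense in Δ, which gives the rest.
  have hint : interior Δ ⊆ U := by
    by_contra hcon
    have hnon : (interior Δ ∩ Uᶜ).Nonempty := by
      obtain ⟨y, hy, hyU⟩ := Set.not_subset.1 hcon
      exact ⟨y, hy, hyU⟩
    have hpos := (isOpen_interior.inter hUc.isOpen_compl).measure_pos volume hnon
    refine hpos.ne' (measure_mono_null ?_ hN0)
    rintro y ⟨hy, hyU⟩
    exact (hcov (interior_subset hy)).resolve_left hyU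
  have hxU : x ∈ U := by
    have h1 : x ∈ closure (interior Δ) := by
      rw [hΔ.closure_interior_eq_closure_of_nonempty_interior hne]
      exact subset_closure hx
    exact closure_minimal hint hUc h1
  obtain ⟨τ, hτ, hxτ⟩ := Set.mem_iUnion₂.1 hxU
  exact ⟨τ, hτ, hxτ⟩

/-- The affine basis of the vertices of a maximal simplex. -/
noncomputable def vertexBasis (τ : simplices Γ n) : AffineBasis τ.1 ℝ (Fin n → ℝ) :=
  simplexBasis τ.1 (Γ.indep τ.2.1) τ.2.2

@[simp]
theorem vertexBasis_apply (τ : simplices Γ n) (v : τ.1) : vertexBasis τ v = v := rfl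

theorem range_vertexBasis (τ : simplices Γ n) : Set.range (vertexBasis τ) = τ.1 :=
  range_simplexBasis _ _ _

theorem mem_convexHull_iff_coord (τ : simplices Γ n) {x : Fin n → ℝ} :
    x ∈ convexHull ℝ (τ.1 : Set (Fin n → ℝ)) ↔ ∀ v, 0 ≤ (vertexBasis τ).coord v x := by
  rw [← range_vertexBasis τ, (vertexBasis τ).convexHull_eq_nonneg_coord]
  rfl

theorem coord_of_mem (τ : simplices Γ n) (v : τ.1) {u : Fin n → ℝ} (hu : u ∈ τ.1) :
    (vertexBasis τ).coord v u = if (v : Fin n → ℝ) = u then 1 else 0 := by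
  have := (vertexBasis τ).coord_apply v ⟨u, hu⟩
  rw [vertexBasis_apply] at this
  rw [this]
  simp [Subtype.ext_iff]

theorem map_eq_of_mem_convexHull {s : Set (Fin n → ℝ)} (g : (Fin n → ℝ) →ᵃ[ℝ] ℝ) {c : ℝ}
    (hg : ∀ u ∈ s, g u = c) {x : Fin n → ℝ} (hx : x ∈ convexHull ℝ s) : g x = c :=
  (convexHull_min (t := g ⁻¹' {c}) hg ((convex_singleton c).affine_preimage g)) hx

theorem coord_barycenter_pos (τ : simplices Γ n) (v : τ.1) {σ : Finset (Fin n → ℝ)}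
    (hσ : σ ⊆ τ.1) (hv : (v : Fin n → ℝ) ∈ σ) : 0 < (vertexBasis τ).coord v (barycenter σ) := by
  rw [map_barycenter ⟨_, hv⟩]
  have hc : 0 < σ.card := Finset.card_pos.2 ⟨_, hv⟩
  rw [Finset.sum_congr rfl fun u hu => coord_of_mem τ v (hσ hu), Finset.sum_ite_eq, if_pos hv]
  positivity

theorem coord_barycenter_eq_zero (τ : simplices Γ n) (v : τ.1) {σ : Finset (Fin n → ℝ)}
    (hσ : σ ⊆ τ.1) (hne : σ.Nonempty) (hv : (v : Fin n → ℝ) ∉ σ) :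
    (vertexBasis τ).coord v (barycenter σ) = 0 := by
  rw [map_barycenter hne, Finset.sum_congr rfl fun u hu => coord_of_mem τ v (hσ hu),
    Finset.sum_ite_eq, if_neg hv, mul_zero]

/-- Two maximal simplices with a common facet lie on different sides of it. -/
theorem coord_neg_of_erase_eq (τ₁ τ₂ : simplices Γ n) (hn : 0 < n) (v₁ : τ₁.1) (v₂ : τ₂.1)
    (he : τ₁.1.erase v₁ = τ₂.1.erase v₂) (hne : τ₁ ≠ τ₂) :
    (vertexBasis τ₁).coord v₁ v₂ < 0 := by
  set σ := τ₁.1.erase v₁ with hσ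
  have hσ1 : σ ⊆ τ₁.1 := Finset.erase_subset _ _
  have hσ2 : σ ⊆ τ₂.1 := he ▸ Finset.erase_subset _ _
  have hcσ : σ.card = n := by rw [hσ, Finset.card_erase_of_mem v₁.2, τ₁.2.2]; omega
  have hσne : σ.Nonempty := Finset.card_pos.1 (by omega)
  have hv12 : (v₁ : Fin n → ℝ) ≠ v₂ := by
    intro heq
    apply hne
    apply Subtype.ext
    rw [← Finset.insert_erase v₁.2, ← Finset.insert_erase v₂.2, ← hσ, ← he, heq]
  -- Otherwise a small move from the barycenter of `σ` towards `v₂` stays in both simplices, hence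
  -- in their common face. There the coordinate of `τ₂` at `v₂` is zero, but after a move by `t` it
  -- equals `t > 0`.
  by_contra! hcon
  have hev : ∀ᶠ t in nhdsWithin (0 : ℝ) (Set.Ioi 0),
      ∀ u : τ₁.1, 0 ≤ (vertexBasis τ₁).coord u (AffineMap.lineMap (barycenter σ) v₂.1 t) := by
    rw [Filter.eventually_all]
    intro u
    by_cases hu : (u : Fin n → ℝ) ∈ σ
    · have hpos := coord_barycenter_pos τ₁ u hσ1 hu
      have hcont : Continuous fun t : ℝ =>
          (vertexBasis τ₁).coord u (AffineMap.lineMap (barycenter σ) v₂.1 t) := by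
        simp_rw [AffineMap.apply_lineMap]
        exact AffineMap.lineMap_continuous
      have h0 := hcont.tendsto 0
      simp only [AffineMap.lineMap_apply_zero] at h0
      exact ((h0.eventually (lt_mem_nhds hpos)).mono fun _ h => h.le).filter_mono
        nhdsWithin_le_nhds
    · have huv : u = v₁ := by
        by_contra hcon'
        exact hu (Finset.mem_erase.2 ⟨fun h => hcon' (Subtype.ext h), u.2⟩)
      filter_upwards [self_mem_nhdsWithin] with t ht
      rw [AffineMap.apply_lineMap, coord_barycenter_eq_zero τ₁ u hσ1 hσne hu, huv,
        AffineMap.lineMap_apply]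
      simp only [vsub_eq_sub, sub_zero, smul_eq_mul, vadd_eq_add, add_zero]
      exact mul_nonneg (le_of_lt ht) hcon
  have hlt : ∀ᶠ t in nhdsWithin (0 : ℝ) (Set.Ioi 0), t < 1 :=
    nhdsWithin_le_nhds (gt_mem_nhds one_pos)
  obtain ⟨t, ⟨ht1, ht2⟩, ht0⟩ := ((hev.and hlt).and self_mem_nhdsWithin).exists
  have ht0 : 0 < t := ht0
  set z : Fin n → ℝ := AffineMap.lineMap (barycenter σ) v₂.1 t with hz
  have hz1 : z ∈ convexHull ℝ (τ₁.1 : Set (Fin n → ℝ)) := (mem_convexHull_iff_coord τ₁).2 ht1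
  have hz2 : z ∈ convexHull ℝ (τ₂.1 : Set (Fin n → ℝ)) :=
    (convex_convexHull ℝ _).lineMap_mem
      (convexHull_mono (by exact_mod_cast hσ2) (barycenter_mem_convexHull hσne))
      (subset_convexHull ℝ _ v₂.2) ⟨ht0.le, ht2.le⟩
  have hz3 := Γ.inter_subset_convexHull τ₁.2.1 τ₂.2.1 ⟨hz1, hz2⟩
  have hv2σ : (v₂ : Fin n → ℝ) ∉ σ := by rw [he]; simp
  have hzero : (vertexBasis τ₂).coord v₂ z = 0 := by
    refine map_eq_of_mem_convexHull _ (fun u hu => ?_) hz3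
    rw [coord_of_mem τ₂ v₂ hu.2, if_neg]
    rintro rfl
    exact hv2σ (Finset.mem_erase.2 ⟨hv12.symm, hu.1⟩)
  rw [hz, AffineMap.apply_lineMap, coord_barycenter_eq_zero τ₂ v₂ hσ2 hσne hv2σ,
    coord_of_mem τ₂ v₂ v₂.2, if_pos rfl, AffineMap.lineMap_apply] at hzero
  simp at hzero
  exact ht0.ne' hzero

theorem exists_eq_erase {σ : Finset (Fin n → ℝ)} (hσ : σ.card = n) (τ : simplices Γ n)
    (h : σ ⊆ τ.1) : ∃ v : τ.1, τ.1.erase v = σ := by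
  obtain ⟨v, hv⟩ := Finset.exists_eq_insert_iff.2 ⟨h, by rw [hσ, τ.2.2]⟩
  exact ⟨⟨v, hv.2 ▸ Finset.mem_insert_self _ _⟩, by
    show τ.1.erase v = σ
    rw [← hv.2, Finset.erase_insert hv.1]⟩

/-- A facet lies in at most two maximal simplices. -/
theorem eq_or_eq_of_subset (hn : 0 < n) {σ : Finset (Fin n → ℝ)} (hσ : σ.card = n)
    {τ₁ τ₂ τ₃ : simplices Γ n} (h₁ : σ ⊆ τ₁.1) (h₂ : σ ⊆ τ₂.1) (h₃ : σ ⊆ τ₃.1) (h12 : τ₁ ≠ τ₂) :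
    τ₃ = τ₁ ∨ τ₃ = τ₂ := by
  by_contra! hcon
  obtain ⟨v₁, hv₁⟩ := exists_eq_erase hσ τ₁ h₁
  obtain ⟨v₂, hv₂⟩ := exists_eq_erase hσ τ₂ h₂
  obtain ⟨v₃, hv₃⟩ := exists_eq_erase hσ τ₃ h₃
  have a := coord_neg_of_erase_eq τ₁ τ₃ hn v₁ v₃ (hv₁.trans hv₃.symm) hcon.1.symm
  have b := coord_neg_of_erase_eq τ₂ τ₃ hn v₂ v₃ (hv₂.trans hv₃.symm) hcon.2.symm
  have c := coord_neg_of_erase_eq τ₂ τ₁ hn v₂ v₁ (hv₂.trans hv₁.symm) h12.symm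
  -- Both coordinates vanish on `σ`, so they are proportional. Three points off a hyperplane cannot
  -- lie pairwise on opposite sides of it.
  have hprop : (vertexBasis τ₂).coord v₂ v₃ =
      (vertexBasis τ₁).coord v₁ v₃ * (vertexBasis τ₂).coord v₂ v₁ := by
    have hcomb := (vertexBasis τ₁).affineCombination_coord_eq_self v₃.1
    have hsum := (vertexBasis τ₁).sum_coord_apply_eq_one v₃.1
    conv_lhs => rw [← hcomb]
    rw [Finset.map_affineCombination _ _ _ hsum,
      Finset.affineCombination_eq_linear_combination _ _ _ hsum, Finset.sum_eq_single v₁]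
    · rfl
    · intro u _ hu
      have huσ : (u : Fin n → ℝ) ∈ σ :=
        hv₁ ▸ Finset.mem_erase.2 ⟨fun h => hu (Subtype.ext h), u.2⟩
      have : (vertexBasis τ₂).coord v₂ u = 0 := by
        rw [coord_of_mem τ₂ v₂ (h₂ huσ), if_neg]
        rintro h
        rw [← hv₂, ← h] at huσ
        simp at huσ
      simp [this]
    · simp
  have := mul_pos_of_neg_of_neg a c
  linarith

/-- Every facet lies in a maximal simplex. -/
theorem exists_superset_simplex (h : IsUnimodularTriangulation Γ Δ) (hΔ : Convex ℝ Δ)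
    (hne : (interior Δ).Nonempty) {σ : Finset (Fin n → ℝ)} (hσ : σ ∈ Γ.faces) :
    ∃ τ : simplices Γ n, σ ⊆ τ.1 := by
  have hmem : barycenter σ ∈ Δ := h.space_eq ▸ Γ.convexHull_subset_space hσ
    (barycenter_mem_convexHull (Γ.nonempty_of_mem_faces hσ))
  obtain ⟨τ, hτ, hx⟩ := exists_simplex_mem h hΔ hne hmem
  exact ⟨⟨τ, hτ⟩, subset_of_barycenter_mem hσ hτ.1 hx⟩

/-- A facet whose barycenter is an interior point lies in two maximal simplices. -/
theorem exists_two_superset_simplices (h : IsUnimodularTriangulation Γ Δ)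
    (hΔ : Convex ℝ Δ) {σ : Finset (Fin n → ℝ)} (hσ : σ ∈ Γ.faces) (hc : σ.card = n)
    (hb : barycenter σ ∈ interior Δ) :
    ∃ τ₁ τ₂ : simplices Γ n, τ₁ ≠ τ₂ ∧ σ ⊆ τ₁.1 ∧ σ ⊆ τ₂.1 := by
  have hne : (interior Δ).Nonempty := ⟨_, hb⟩
  obtain ⟨τ₁, h₁⟩ := exists_superset_simplex h hΔ hne hσ
  obtain ⟨v, hv⟩ := exists_eq_erase hc τ₁ h₁
  set g := (vertexBasis τ₁).coord v with hg
  have hg0 : g (barycenter σ) = 0 :=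
    coord_barycenter_eq_zero τ₁ v h₁ (Γ.nonempty_of_mem_faces hσ) (by rw [← hv]; simp)
  have hgv : g v = 1 := by rw [hg, coord_of_mem τ₁ v v.2, if_pos rfl]
  -- The barycenter is approached from the side of `σ` away from `τ₁`. As finitely many closed
  -- simplices cover that side, one of them contains the limit.
  have hcl : barycenter σ ∈ closure (interior Δ ∩ {x | g x < 0}) := by
    let f : ℝ → (Fin n → ℝ) := fun t => AffineMap.lineMap (barycenter σ) v.1 t
    have hf : Continuous f := AffineMap.lineMap_continuous
    have hf0 : f 0 = barycenter σ := AffineMap.lineMap_apply_zero _ _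
    have ht : Filter.Tendsto f (nhdsWithin 0 (Set.Iio 0)) (nhds (barycenter σ)) := by
      have := hf.tendsto 0
      rw [hf0] at this
      exact this.mono_left nhdsWithin_le_nhds
    refine mem_closure_of_tendsto ht ?_
    filter_upwards [self_mem_nhdsWithin, ht (isOpen_interior.mem_nhds hb)] with t ht0 hti
    refine ⟨hti, ?_⟩
    show g (AffineMap.lineMap (barycenter σ) v.1 t) < 0
    rw [AffineMap.apply_lineMap, hg0, hgv, AffineMap.lineMap_apply]
    simpa using ht0
  have hsub : interior Δ ∩ {x | g x < 0} ⊆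
      ⋃ τ ∈ simplices Γ n, (convexHull ℝ (τ : Set (Fin n → ℝ)) ∩ {x | g x < 0}) := by
    rintro x ⟨hx, hgx⟩
    obtain ⟨τ, hτ, hxτ⟩ := exists_simplex_mem h hΔ hne (interior_subset hx)
    exact Set.mem_biUnion hτ ⟨hxτ, hgx⟩
  have hfin : (simplices Γ n).Finite := h.finite.subset fun _ hσ => hσ.1
  have hcl' := closure_mono hsub hcl
  rw [hfin.closure_biUnion] at hcl'
  obtain ⟨τ₂, hτ₂, hx₂⟩ := Set.mem_iUnion₂.1 hcl'
  refine ⟨τ₁, ⟨τ₂, hτ₂⟩, ?_, h₁, ?_⟩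
  · rintro rfl
    obtain ⟨x, hx, hgx⟩ := closure_nonempty_iff.1 ⟨_, hx₂⟩
    exact absurd ((mem_convexHull_iff_coord _).1 hx v) (not_le.2 hgx)
  · refine subset_of_barycenter_mem hσ hτ₂.1 ?_
    exact closure_minimal Set.inter_subset_left (τ₂.finite_toSet.isClosed_convexHull ℝ) hx₂

/-- The maximal simplices are connected to each other through their facets. -/
theorem forall_simplices_of_adjacent (h : IsUnimodularTriangulation Γ Δ) (hΔ : Convex ℝ Δ)
    (P : simplices Γ n → Prop)
    (hP : ∀ τ₁ τ₂ : simplices Γ n, (τ₁.1 ∩ τ₂.1).card = n → P τ₁ → P τ₂)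
    {τ₁ τ₂ : simplices Γ n} (h₁ : P τ₁) : P τ₂ := by
  by_contra h₂
  have hfin : (simplices Γ n).Finite := h.finite.subset fun _ hσ => hσ.1
  have : Finite (simplices Γ n) := hfin
  have hint : ∀ τ : simplices Γ n,
      (interior (convexHull ℝ (τ.1 : Set (Fin n → ℝ)))).Nonempty := by
    intro τ
    rw [← range_vertexBasis τ, interior_convexHull_nonempty_iff_affineSpan_eq_top]
    exact (vertexBasis τ).tot
  set R : Set (Finset (Fin n → ℝ)) := {ρ ∈ Γ.faces | ρ.card < n} with hR
  have hRfin : R.Finite := h.finite.subset fun _ hσ => hσ.1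
  classical
  -- a point off a finite union of null sets
  have hpick : ∀ (τ : simplices Γ n) (N : Set (Fin n → ℝ)), volume N = 0 →
      ∃ x ∈ convexHull ℝ (τ.1 : Set (Fin n → ℝ)), x ∉ N := by
    intro τ N hN
    by_contra! hcon
    exact (isOpen_interior.measure_pos volume (hint τ)).ne'
      (measure_mono_null (fun x hx => hcon x (interior_subset hx)) hN)
  -- General position: `x` avoids the spans of the faces of codimension at least two, and `y` their
  -- joins with `x`, each spanned by at most n points. The segment from `x` to `y` then misses all
  -- these faces.
  obtain ⟨x, hx, hxN⟩ := hpick τ₁ (⋃ ρ ∈ R, (affineSpan ℝ (ρ : Set (Fin n → ℝ)) : Set _))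
    ((measure_biUnion_null_iff hRfin.countable).2 fun ρ hρ => volume_affineSpan_eq_zero hρ.2.le)
  obtain ⟨y, hy, hyN⟩ := hpick τ₂
    (⋃ ρ ∈ R, (affineSpan ℝ ((insert x ρ : Finset (Fin n → ℝ)) : Set (Fin n → ℝ)) : Set _))
    ((measure_biUnion_null_iff hRfin.countable).2 fun ρ hρ =>
      volume_affineSpan_eq_zero ((Finset.card_insert_le _ _).trans hρ.2))
  have hsubΔ : ∀ τ : simplices Γ n, convexHull ℝ (τ.1 : Set (Fin n → ℝ)) ⊆ Δ := fun τ =>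
    h.space_eq ▸ Γ.convexHull_subset_space τ.2.1
  have hneΔ : (interior Δ).Nonempty := (hint τ₁).mono (interior_mono (hsubΔ τ₁))
  set A : Set (Fin n → ℝ) := ⋃ τ ∈ {τ | P τ}, convexHull ℝ (τ.1 : Set (Fin n → ℝ)) with hA
  set B : Set (Fin n → ℝ) := ⋃ τ ∈ {τ | ¬ P τ}, convexHull ℝ (τ.1 : Set (Fin n → ℝ)) with hB
  have hAc : IsClosed A := (Set.toFinite _).isClosed_biUnion fun τ _ =>
    τ.1.finite_toSet.isClosed_convexHull ℝ
  have hBc : IsClosed B := (Set.toFinite _).isClosed_biUnion fun τ _ =>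
    τ.1.finite_toSet.isClosed_convexHull ℝ
  have hseg : segment ℝ x y ⊆ A ∪ B := by
    intro z hz
    have hzΔ : z ∈ Δ := hΔ.segment_subset (hsubΔ τ₁ hx) (hsubΔ τ₂ hy) hz
    obtain ⟨τ, hτ, hzτ⟩ := exists_simplex_mem h hΔ hneΔ hzΔ
    by_cases hPτ : P ⟨τ, hτ⟩
    · exact Or.inl (Set.mem_biUnion (x := ⟨τ, hτ⟩) hPτ hzτ)
    · exact Or.inr (Set.mem_biUnion (x := ⟨τ, hτ⟩) hPτ hzτ)
  have hpre : IsPreconnected (segment ℝ x y) := (convex_segment x y).isPreconnected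
  -- By connectedness some `z` lies both in a simplex with `P` and in one without. These share no
  -- facet, so `z` is on a face of codimension at least two.
  obtain ⟨z, hz, hzA, hzB⟩ := isPreconnected_closed_iff.1 hpre A B hAc hBc hseg
    ⟨x, left_mem_segment ℝ x y, Set.mem_biUnion (x := τ₁) h₁ hx⟩
    ⟨y, right_mem_segment ℝ x y, Set.mem_biUnion (x := τ₂) h₂ hy⟩
  obtain ⟨τ, hPτ, hzτ⟩ := Set.mem_iUnion₂.1 hzA
  obtain ⟨τ', hPτ', hzτ'⟩ := Set.mem_iUnion₂.1 hzB
  have hz' := Γ.inter_subset_convexHull τ.2.1 τ'.2.1 ⟨hzτ, hzτ'⟩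
  rw [← Finset.coe_inter] at hz'
  have hρne : (τ.1 ∩ τ'.1).Nonempty := by
    rw [← Finset.coe_nonempty, ← convexHull_nonempty_iff (𝕜 := ℝ)]
    exact ⟨z, hz'⟩
  have hρ : τ.1 ∩ τ'.1 ∈ Γ.faces := Γ.down_closed τ.2.1 Finset.inter_subset_left hρne
  have hcard : (τ.1 ∩ τ'.1).card < n := by
    have h1 : (τ.1 ∩ τ'.1).card ≠ n := fun hc => hPτ' (hP τ τ' hc hPτ)
    have h2 : (τ.1 ∩ τ'.1).card ≠ n + 1 := by
      intro hc
      have e1 : τ.1 ∩ τ'.1 = τ.1 := Finset.eq_of_subset_of_card_le Finset.inter_subset_left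
        (by rw [hc, τ.2.2])
      have e2 : τ.1 ∩ τ'.1 = τ'.1 := Finset.eq_of_subset_of_card_le Finset.inter_subset_right
        (by rw [hc, τ'.2.2])
      have : τ = τ' := Subtype.ext (e1.symm.trans e2)
      exact hPτ' (this ▸ hPτ)
    have := card_le_of_mem_faces hρ
    omega
  have hzs := convexHull_subset_affineSpan _ hz'
  have hρR : τ.1 ∩ τ'.1 ∈ R := ⟨hρ, hcard⟩
  obtain ⟨t, -, rfl⟩ := (segment_eq_image_lineMap ℝ x y ▸ hz :)
  rcases eq_or_ne t 0 with rfl | ht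
  · rw [AffineMap.lineMap_apply_zero] at hzs
    exact hxN (Set.mem_biUnion hρR hzs)
  · refine hyN (Set.mem_biUnion hρR ?_)
    -- The point `y` is on the line through `x` and `z`, hence in the span of `x` and the face,
    -- which was excluded.
    have hy' : y = AffineMap.lineMap x (AffineMap.lineMap x y t) t⁻¹ := by
      rw [AffineMap.lineMap_apply, AffineMap.lineMap_apply]
      simp [smul_smul, inv_mul_cancel₀ ht]
    rw [hy']
    refine AffineMap.lineMap_mem _ (subset_affineSpan ℝ _ (by simp)) ?_
    exact affineSpan_mono ℝ (by simp) hzs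

end Triangulation

/-! ### Real phase structures on the facets of a maximal simplex -/

section Local

variable {n : ℕ} {Γ : ComplexIn n} {Δ : Set (Fin n → ℝ)}

theorem vertexBasis_integral (h : IsUnimodularTriangulation Γ Δ) (τ : simplices Γ n) (v : τ.1) :
    ∃ a, vertexBasis τ v = latticePoint a :=
  h.integral v (Γ.down_closed τ.2.1 (Finset.singleton_subset_iff.2 v.2)
    (Finset.singleton_nonempty _))

theorem hasIntegralCoords_vertexBasis (h : IsUnimodularTriangulation Γ Δ) (τ : simplices Γ n) :
    HasIntegralCoords (vertexBasis τ) := by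
  rw [← volume_eq_iff_hasIntegralCoords (by rw [Fintype.card_coe, τ.2.2]) _
    (vertexBasis_integral h τ), range_vertexBasis]
  exact h.unimodular τ.1 τ.2

/-- The facet of a maximal simplex opposite to a vertex. -/
noncomputable def facet (hn : 1 < n) (τ : simplices Γ n) (v : τ.1) : simplices Γ (n - 1) :=
  ⟨τ.1.erase v, Γ.down_closed τ.2.1 (Finset.erase_subset _ _)
    (Finset.card_pos.1 (by rw [Finset.card_erase_of_mem v.2, τ.2.2]; omega)),
    by rw [Finset.card_erase_of_mem v.2, τ.2.2]; omega⟩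

variable (hn : 1 < n)

theorem facet_subset (τ : simplices Γ n) (v : τ.1) : (facet hn τ v).1 ⊆ τ.1 :=
  Finset.erase_subset _ _

theorem facet_injective (τ : simplices Γ n) : Function.Injective (facet hn τ) := by
  intro v w hvw
  have h1 : τ.1.erase v = τ.1.erase w := congrArg Subtype.val hvw
  by_contra hne
  have : (v : Fin n → ℝ) ∈ τ.1.erase w :=
    Finset.mem_erase.2 ⟨fun h => hne (Subtype.ext h), v.2⟩
  rw [← h1] at this
  simp at this

include hn in
theorem exists_facet_eq {τ : simplices Γ n} {σ : simplices Γ (n - 1)} (h : σ.1 ⊆ τ.1) :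
    ∃ v, facet hn τ v = σ := by
  obtain ⟨v, hv⟩ := exists_eq_erase (by rw [σ.2.2]; omega) τ h
  exact ⟨v, Subtype.ext hv⟩

theorem sum_facet [Fintype (simplices Γ (n - 1))] (τ : simplices Γ n)
    (g : simplices Γ (n - 1) → ZMod 2) :
    ∑ v, g (facet hn τ v) = ∑ σ : simplices Γ (n - 1), if σ.1 ⊆ τ.1 then g σ else 0 := by
  classical
  rw [← Finset.sum_filter,
    show Finset.univ.filter (fun σ : simplices Γ (n - 1) => σ.1 ⊆ τ.1) =
      Finset.univ.image (facet hn τ) from ?_,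
    Finset.sum_image fun _ _ _ _ h => facet_injective hn τ h]
  ext σ
  simp only [Finset.mem_filter, Finset.mem_univ, true_and, Finset.mem_image]
  constructor
  · exact fun h => exists_facet_eq hn h
  · rintro ⟨v, rfl⟩
    exact facet_subset hn τ v

theorem image_compl_vertexBasis (τ : simplices Γ n) (v : τ.1) :
    (vertexBasis τ) '' {v}ᶜ = ((facet hn τ v).1 : Set (Fin n → ℝ)) := by
  ext x
  simp only [Set.mem_image, Set.mem_compl_iff, Set.mem_singleton_iff, vertexBasis_apply, facet,
    Finset.coe_erase, Set.mem_sdiff, Finset.mem_coe]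
  constructor
  · rintro ⟨u, hu, rfl⟩
    exact ⟨u.2, fun h => hu (Subtype.ext h)⟩
  · rintro ⟨hx, hxv⟩
    exact ⟨⟨x, hx⟩, fun h => hxv (congrArg Subtype.val h), rfl⟩

theorem mem_tangentTwoPerp_facet_iff (h : IsUnimodularTriangulation Γ Δ) (τ : simplices Γ n)
    (v : τ.1) {β : Orthant n} :
    β ∈ tangentTwoPerp (convexHull ℝ ((facet hn τ v).1 : Set (Fin n → ℝ))) ↔
      β = 0 ∨ β = (hasIntegralCoords_vertexBasis h τ).normal v := by
  obtain ⟨k, hk⟩ : ∃ k : τ.1, k ≠ v := by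
    have : Nontrivial τ.1 := by
      rw [← Fintype.one_lt_card_iff_nontrivial, Fintype.card_coe, τ.2.2]; omega
    exact exists_ne v
  rw [← image_compl_vertexBasis hn τ v]
  exact (hasIntegralCoords_vertexBasis h τ).mem_tangentTwoPerp_facet (vertexBasis_integral h τ) hk

/-- Each phase of a real phase structure on the facets consists of two orthants, which differ by
the normal of the facet. -/
theorem exists_phase_eq_pair (h : IsUnimodularTriangulation Γ Δ) (hΔ : Convex ℝ Δ)
    (hne : (interior Δ).Nonempty) (E : RealPhaseStructure Γ (n - 1)) :
    ∃ p q : simplices Γ (n - 1) → Orthant n, (∀ σ, p σ ≠ q σ) ∧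
      (∀ σ s, s ∈ E.phase σ ↔ s = p σ ∨ s = q σ) ∧
      ∀ (τ : simplices Γ n) (v : τ.1), p (facet hn τ v) + q (facet hn τ v) =
        (hasIntegralCoords_vertexBasis h τ).normal v := by
  have hall : ∀ σ : simplices Γ (n - 1), ∃ p q : Orthant n, p ≠ q ∧
      (∀ s, s ∈ E.phase σ ↔ s = p ∨ s = q) := by
    intro σ
    obtain ⟨τ, hτ⟩ := exists_superset_simplex h hΔ hne σ.2.1
    obtain ⟨v, rfl⟩ := exists_facet_eq hn hτ
    obtain ⟨p, hp⟩ := E.nonempty (facet hn τ v)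
    set α := (hasIntegralCoords_vertexBasis h τ).normal v with hα
    -- A single facet is neither the empty set nor the set of all n + 1 facets.
    have hα0 : α ≠ 0 := by
      intro h0
      have hs := (hasIntegralCoords_vertexBasis h τ).sum_normal_eq_zero
        (vertexBasis_integral h τ) (S := {v}) (by rw [Finset.sum_singleton, ← hα, h0])
      have hc : (Finset.univ : Finset τ.1).card = n + 1 := by
        rw [Finset.card_univ, Fintype.card_coe, τ.2.2]
      rcases hs with hs | hs
      · simp at hs
      · rw [← hs, Finset.card_singleton] at hc
        omega
    refine ⟨p, p + α, fun heq => hα0 (by simpa using heq), fun s => ?_⟩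
    rw [← AffineSubspace.vsub_left_mem_direction_iff_mem hp, E.direction_eq,
      mem_tangentTwoPerp_facet_iff hn h, vsub_eq_sub, sub_eq_zero, ← hα, ZModModule.sub_eq_add]
    refine or_congr eq_comm ⟨?_, ?_⟩
    · intro hs
      rw [← hs, ← add_assoc, ZModModule.add_self, zero_add]
    · rintro rfl
      rw [← add_assoc, ZModModule.add_self, zero_add]
  choose p q hpq hE using hall
  refine ⟨p, q, hpq, hE, fun τ v => ?_⟩
  have hp : p (facet hn τ v) ∈ E.phase (facet hn τ v) := (hE _ _).2 (Or.inl rfl)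
  have hq : q (facet hn τ v) ∈ E.phase (facet hn τ v) := (hE _ _).2 (Or.inr rfl)
  have hd := AffineSubspace.vsub_mem_direction hp hq
  rw [E.direction_eq, mem_tangentTwoPerp_facet_iff hn h, vsub_eq_sub, sub_eq_zero] at hd
  rw [← ZModModule.sub_eq_add]
  exact hd.resolve_left (hpq _)

/-- The coefficient at an orthant s counts modulo two the facets of τ whose phase contains s, so
this is the parity axiom at τ. -/
theorem sum_ends_facet (E : RealPhaseStructure Γ (n - 1))
    {p q : simplices Γ (n - 1) → Orthant n} (hpq : ∀ σ, p σ ≠ q σ)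
    (hE : ∀ σ s, s ∈ E.phase σ ↔ s = p σ ∨ s = q σ) (τ : simplices Γ n) :
    ∑ v, ends (fun v => p (facet hn τ v)) (fun v => q (facet hn τ v)) v = 0 := by
  classical
  ext s
  have hpar := E.parity τ.1 ⟨τ.2.1, by rw [τ.2.2]; omega⟩ s
  have himg : {σ : simplices Γ (n - 1) | (σ : Finset (Fin n → ℝ)) ⊆ τ.1 ∧ s ∈ E.phase σ} =
      facet hn τ '' {v | s ∈ E.phase (facet hn τ v)} := by
    ext σ
    constructor
    · rintro ⟨h1, h2⟩
      obtain ⟨v, rfl⟩ := exists_facet_eq hn h1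
      exact ⟨v, h2, rfl⟩
    · rintro ⟨v, hv, rfl⟩
      exact ⟨facet_subset hn τ v, hv⟩
  rw [himg, Set.ncard_image_of_injective _ (facet_injective hn τ),
    Set.ncard_eq_toFinset_card'] at hpar
  rw [Finsupp.finsetSum_apply, Finsupp.zero_apply]
  have hterm : ∀ v : τ.1, ends (fun v => p (facet hn τ v)) (fun v => q (facet hn τ v)) v s =
      if s ∈ E.phase (facet hn τ v) then 1 else 0 := by
    intro v
    rw [ends, Finsupp.add_apply, Finsupp.single_apply, Finsupp.single_apply]
    by_cases h1 : s = p (facet hn τ v)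
    · have h2 : q (facet hn τ v) ≠ s := fun h => hpq _ (h1.symm.trans h.symm)
      rw [if_pos h1.symm, if_neg h2, if_pos ((hE _ _).2 (Or.inl h1)), add_zero]
    · by_cases h2 : s = q (facet hn τ v)
      · rw [if_neg (Ne.symm h1), if_pos h2.symm, if_pos ((hE _ _).2 (Or.inr h2)), zero_add]
      · rw [if_neg (Ne.symm h1), if_neg (Ne.symm h2),
          if_neg fun h => ((hE _ _).1 h).elim h1 h2, add_zero]
  simp_rw [hterm]
  rw [Finset.sum_boole]
  convert (ZMod.natCast_eq_zero_iff_even).2 hpar using 3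
  ext v
  simp

/-- Around a maximal simplex the phases of the facets form an Euler circuit. -/
theorem exists_isTrail_facet (h : IsUnimodularTriangulation Γ Δ) (E : RealPhaseStructure Γ (n - 1))
    {p q : simplices Γ (n - 1) → Orthant n} (hpq : ∀ σ, p σ ≠ q σ)
    (hE : ∀ σ s, s ∈ E.phase σ ↔ s = p σ ∨ s = q σ)
    (hnormal : ∀ (τ : simplices Γ n) (v : τ.1), p (facet hn τ v) + q (facet hn τ v) =
        (hasIntegralCoords_vertexBasis h τ).normal v) (τ : simplices Γ n) :
    ∃ s e, IsTrail (fun v => p (facet hn τ v)) (fun v => q (facet hn τ v))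
      (Fintype.card τ.1) s e := by
  have : Nonempty τ.1 := (Γ.nonempty_of_mem_faces τ.2.1).to_subtype
  refine exists_isTrail_card (sum_ends_facet hn E hpq hE τ) fun S hS => ?_
  refine (hasIntegralCoords_vertexBasis h τ).sum_normal_eq_zero (vertexBasis_integral h τ) ?_
  -- Evaluating formal sums of orthants in the dual of 𝔽₂ⁿ sends the ends of an edge to the normal p
  -- + q, so an even set of facets has normals with sum zero.
  have := congrArg (Finsupp.linearCombination (ZMod 2) (id : Orthant n → Orthant n)) hS
  rw [map_sum, map_zero] at this
  rw [← this]
  refine Finset.sum_congr rfl fun v _ => ?_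
  rw [ends, map_add, Finsupp.linearCombination_single, Finsupp.linearCombination_single,
    one_smul, one_smul]
  exact (hnormal τ v).symm

end Local

/-! ### Supporting hyperplanes at barycenters -/

section Support

variable {n : ℕ} {Γ : ComplexIn n} {Δ : Set (Fin n → ℝ)}

theorem exists_support (hΔ : Convex ℝ Δ) (hne : (interior Δ).Nonempty) {x : Fin n → ℝ}
    (hx : x ∉ interior Δ) : ∃ f : StrongDual ℝ (Fin n → ℝ),
      (∀ a ∈ interior Δ, f a < f x) ∧ ∀ y ∈ Δ, f y ≤ f x := by
  obtain ⟨f, hf⟩ := geometric_hahn_banach_open_point hΔ.interior isOpen_interior hx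
  refine ⟨f, hf, fun y hy => ?_⟩
  have hcl : y ∈ closure (interior Δ) := by
    rw [hΔ.closure_interior_eq_closure_of_nonempty_interior hne]
    exact subset_closure hy
  exact closure_minimal (fun a ha => (hf a ha).le) (isClosed_le f.continuous continuous_const) hcl

/-- The value at the barycenter is the average of the values at the vertices; an average that bounds
all its terms equals each of them. -/
theorem eq_of_le_map_barycenter {σ : Finset (Fin n → ℝ)} (f : StrongDual ℝ (Fin n → ℝ))
    (hf : ∀ v ∈ σ, f v ≤ f (barycenter σ)) {v : Fin n → ℝ} (hv : v ∈ σ) :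
    f v = f (barycenter σ) := by
  have hne : σ.Nonempty := ⟨v, hv⟩
  have hb := map_barycenter hne (f : (Fin n → ℝ) →ₗ[ℝ] ℝ).toAffineMap
  simp only [LinearMap.coe_toAffineMap, ContinuousLinearMap.coe_coe] at hb
  have hc : (0 : ℝ) < σ.card := by exact_mod_cast hne.card_pos
  have hsum : ∑ u ∈ σ, (f (barycenter σ) - f u) = 0 := by
    rw [Finset.sum_sub_distrib, Finset.sum_const, nsmul_eq_mul]
    nth_rewrite 1 [hb]
    field_simp
    ring
  have := (Finset.sum_eq_zero_iff_of_nonneg fun u hu => sub_nonneg.2 (hf u hu)).1 hsum v hv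
  linarith

theorem barycenter_mem (h : IsUnimodularTriangulation Γ Δ) {σ : Finset (Fin n → ℝ)}
    (hσ : σ ∈ Γ.faces) : barycenter σ ∈ Δ :=
  h.space_eq ▸ Γ.convexHull_subset_space hσ
    (barycenter_mem_convexHull (Γ.nonempty_of_mem_faces hσ))

theorem mem_of_mem_face (h : IsUnimodularTriangulation Γ Δ) {σ : Finset (Fin n → ℝ)}
    (hσ : σ ∈ Γ.faces) {v : Fin n → ℝ} (hv : v ∈ σ) : v ∈ Δ :=
  h.space_eq ▸ Γ.subset_space hσ hv

/-- A functional supporting Δ at a boundary barycenter would be constant on σ, but it is strictly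
smaller at the interior vertex v. -/
theorem barycenter_mem_interior (h : IsUnimodularTriangulation Γ Δ) (hΔ : Convex ℝ Δ)
    {σ : Finset (Fin n → ℝ)} (hσ : σ ∈ Γ.faces) {v : Fin n → ℝ} (hv : v ∈ σ)
    (hvi : v ∈ interior Δ) : barycenter σ ∈ interior Δ := by
  by_contra hb
  obtain ⟨f, hf, hf'⟩ := exists_support hΔ ⟨v, hvi⟩ hb
  exact (hf v hvi).ne
    (eq_of_le_map_barycenter f (fun u hu => hf' u (mem_of_mem_face h hσ hu)) hv)

/-- The two copies of a facet on the boundary are glued to each other. -/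
theorem glued_of_notMem_interior (hn : 1 < n) (h : IsUnimodularTriangulation Γ Δ)
    (hΔ : Convex ℝ Δ) (hne : (interior Δ).Nonempty) (τ : simplices Γ n) (v : τ.1)
    (hb : barycenter (facet hn τ v).1 ∉ interior Δ) {s t : Orthant n}
    (hst : t - s = (hasIntegralCoords_vertexBasis h τ).normal v)
    (hmem : barycenter (facet hn τ v).1 ∈ Δ) :
    Glued Δ ⟨s, ⟨barycenter (facet hn τ v).1, hmem⟩⟩
      ⟨t, ⟨barycenter (facet hn τ v).1, hmem⟩⟩ := by
  obtain ⟨f, hf, hf'⟩ := exists_support hΔ hne hb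
  set x := barycenter (facet hn τ v).1 with hx
  -- The face used for gluing is the one exposed by the supporting functional.
  refine ⟨rfl, {z ∈ Δ | ∀ y ∈ Δ, f y ≤ f z}, fun _ => ⟨f, rfl⟩, ⟨hmem, hf'⟩, ?_⟩
  rw [hst]
  refine (hasIntegralCoords_vertexBasis h τ).normal_mem_tangentTwoPerp v ?_
  rintro z ⟨hz, hzmax⟩
  have hfz : f z = f x := le_antisymm (hf' z hz) (hzmax x hmem)
  have hfac : ∀ u ∈ (facet hn τ v).1, f u = f x := fun u hu =>
    eq_of_le_map_barycenter f (fun w hw => hf' w (mem_of_mem_face h (facet hn τ v).2.1 hw)) hu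
  -- Since `f` is constant on the facet, it depends only on the coordinate opposite to it. That
  -- coordinate thus vanishes on the exposed face.
  have hexp : ∀ y : Fin n → ℝ, f y = f x + (vertexBasis τ).coord v y * (f v - f x) := by
    intro y
    have hcomb := (vertexBasis τ).linear_combination_coord_eq_self y
    have hsum := (vertexBasis τ).sum_coord_apply_eq_one y
    have h1 : f y = ∑ u, (vertexBasis τ).coord u y * f u := by
      conv_lhs => rw [← hcomb]
      rw [map_sum]
      simp
    have h2 : f y - f x = ∑ u, (vertexBasis τ).coord u y * (f u - f x) := by
      simp_rw [mul_sub, Finset.sum_sub_distrib, ← Finset.sum_mul, hsum, one_mul, h1]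
    rw [Finset.sum_eq_single v] at h2
    · linarith
    · intro u _ hu
      rw [hfac u (Finset.mem_erase.2 ⟨fun h => hu (Subtype.ext h), u.2⟩), sub_self, mul_zero]
    · simp
  have hfv : f v - f x ≠ 0 := by
    intro h0
    obtain ⟨a, ha⟩ := hne
    have := hexp a
    rw [h0, mul_zero, add_zero] at this
    exact (hf a ha).ne this
  have hz' := hexp z
  rw [hfz] at hz'
  have : (vertexBasis τ).coord v z * (f v - f x) = 0 := by linarith
  exact (mul_eq_zero.1 this).resolve_right hfv

end Support

/-! ### Connected components of the T-manifold -/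

section Components

variable {n k : ℕ} {Γ : ComplexIn n} {Δ : Set (Fin n → ℝ)} (E : RealPhaseStructure Γ k)

open Classical in
/-- The value at the copy `s(y)` of a point of a function on the set of components of the
T-manifold, or `0` if `s(y)` is not on the T-manifold. -/
noncomputable def componentValue : (ConnectedComponents (tManifold Δ E) → ZMod 2) →ₗ[ZMod 2]
    (Orthant n → (Fin n → ℝ) → ZMod 2) where
  toFun F s y := if h : ∃ hy : y ∈ Δ,
      (Quot.mk _ ⟨s, ⟨y, hy⟩⟩ : GluedPolytope Δ) ∈ tManifold Δ E then
    F (ConnectedComponents.mk ⟨_, h.choose_spec⟩) else 0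
  map_add' F G := by
    ext s y
    by_cases h : ∃ hy : y ∈ Δ, (Quot.mk _ ⟨s, ⟨y, hy⟩⟩ : GluedPolytope Δ) ∈ tManifold Δ E <;>
      simp [h]
  map_smul' c F := by
    ext s y
    by_cases h : ∃ hy : y ∈ Δ, (Quot.mk _ ⟨s, ⟨y, hy⟩⟩ : GluedPolytope Δ) ∈ tManifold Δ E <;>
      simp [h]

theorem componentValue_of_mem (F : ConnectedComponents (tManifold Δ E) → ZMod 2) {s : Orthant n}
    {y : Fin n → ℝ} (hy : y ∈ Δ)
    (h : (Quot.mk _ ⟨s, ⟨y, hy⟩⟩ : GluedPolytope Δ) ∈ tManifold Δ E) :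
    componentValue E F s y = F (ConnectedComponents.mk ⟨_, h⟩) := by
  have h' : ∃ hy : y ∈ Δ, (Quot.mk _ ⟨s, ⟨y, hy⟩⟩ : GluedPolytope Δ) ∈ tManifold Δ E := ⟨hy, h⟩
  exact dif_pos h'

variable {E}

/-- The hull of the barycenters is convex and maps continuously into the T-manifold, so its image
lies in one component. -/
theorem componentValue_eq_of_chain (hΔ : Convex ℝ Δ) (h : Γ.space = Δ)
    (F : ConnectedComponents (tManifold Δ E) → ZMod 2) {s : Orthant n}
    {c : Finset (Finset (Fin n → ℝ))} (hc : IsChain (· ⊆ ·) (c : Set (Finset (Fin n → ℝ))))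
    (hcs : ∀ σ ∈ c, σ ∈ Γ.faces ∧ s ∈ E.orthants σ) {y z : Fin n → ℝ}
    (hy : y ∈ convexHull ℝ (barycenter '' (c : Set (Finset (Fin n → ℝ)))))
    (hz : z ∈ convexHull ℝ (barycenter '' (c : Set (Finset (Fin n → ℝ))))) :
    componentValue E F s y = componentValue E F s z := by
  set K := convexHull ℝ (barycenter '' (c : Set (Finset (Fin n → ℝ)))) with hK
  have hKΔ : K ⊆ Δ := by
    refine convexHull_min ?_ hΔ
    rintro _ ⟨σ, hσ, rfl⟩
    exact h ▸ Γ.convexHull_subset_space (hcs σ hσ).1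
      (barycenter_mem_convexHull (Γ.nonempty_of_mem_faces (hcs σ hσ).1))
  have hKX : ∀ x : K, (Quot.mk _ ⟨s, ⟨x, hKΔ x.2⟩⟩ : GluedPolytope Δ) ∈ tManifold Δ E := fun x =>
    ⟨⟨s, ⟨x, hKΔ x.2⟩⟩, ⟨c, hc, hcs, x.2⟩, rfl⟩
  let j : K → tManifold Δ E := fun x => ⟨_, hKX x⟩
  have hj : Continuous j := by
    refine Continuous.subtype_mk (continuous_quot_mk.comp ?_) _
    exact continuous_sigmaMk.comp (continuous_subtype_val.subtype_mk _)
  have : PreconnectedSpace K :=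
    Subtype.preconnectedSpace (convex_convexHull ℝ _).isPreconnected
  have hmem : j ⟨y, hy⟩ ∈ connectedComponent (j ⟨z, hz⟩) :=
    (isPreconnected_range hj).subset_connectedComponent ⟨_, rfl⟩ ⟨_, rfl⟩
  rw [componentValue_of_mem E F (hKΔ hy) (hKX ⟨y, hy⟩),
    componentValue_of_mem E F (hKΔ hz) (hKX ⟨z, hz⟩)]
  exact congrArg F (ConnectedComponents.coe_eq_coe'.2 hmem)

theorem mem_orthants_of_subset {σ : simplices Γ k} {τ : Finset (Fin n → ℝ)} {s : Orthant n}
    (hs : s ∈ E.phase σ) (h : (σ : Finset (Fin n → ℝ)) ⊆ τ) : s ∈ E.orthants τ :=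
  ⟨σ, h, hs⟩

/-- Barycenters of incident simplices are in the same component. -/
theorem componentValue_barycenter_eq (hΔ : Convex ℝ Δ) (h : Γ.space = Δ)
    (F : ConnectedComponents (tManifold Δ E) → ZMod 2) {s : Orthant n} {σ : simplices Γ k}
    (hs : s ∈ E.phase σ) {τ : Finset (Fin n → ℝ)} (hτ : τ ∈ Γ.faces)
    (hστ : (σ : Finset (Fin n → ℝ)) ⊆ τ) :
    componentValue E F s (barycenter σ.1) = componentValue E F s (barycenter τ) := by
  classical
  refine componentValue_eq_of_chain hΔ h F (c := {σ.1, τ}) ?_ ?_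
    (subset_convexHull ℝ _ ⟨σ.1, by simp, rfl⟩) (subset_convexHull ℝ _ ⟨τ, by simp, rfl⟩)
  · intro a ha b hb _
    simp only [Finset.coe_insert, Finset.coe_singleton, Set.mem_insert_iff,
      Set.mem_singleton_iff] at ha hb
    rcases ha with rfl | rfl <;> rcases hb with rfl | rfl
    · exact Or.inl subset_rfl
    · exact Or.inl hστ
    · exact Or.inr hστ
    · exact Or.inl subset_rfl
  · intro a ha
    simp only [Finset.mem_insert, Finset.mem_singleton] at ha
    rcases ha with rfl | rfl
    · exact ⟨σ.2.1, mem_orthants_of_subset hs subset_rfl⟩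
    · exact ⟨hτ, mem_orthants_of_subset hs hστ⟩

/-- Every component of the T-manifold contains the barycenter of a copy of a `k`-simplex. -/
theorem exists_componentValue_eq (hΔ : Convex ℝ Δ) (h : Γ.space = Δ)
    (x : ConnectedComponents (tManifold Δ E)) :
    ∃ (σ : simplices Γ k) (s : Orthant n), s ∈ E.phase σ ∧
      ∀ F, componentValue E F s (barycenter σ.1) = F x := by
  obtain ⟨⟨_, ⟨⟨s, y, hy⟩, ⟨c, hc, hcs, hyc⟩, rfl⟩⟩, rfl⟩ := ConnectedComponents.surjective_coe x
  obtain ⟨_, τ, hτ, -⟩ : (barycenter '' (c : Set (Finset (Fin n → ℝ)))).Nonempty := by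
    rw [← convexHull_nonempty_iff (𝕜 := ℝ)]
    exact ⟨_, hyc⟩
  obtain ⟨σ, hστ, hs⟩ := (hcs τ hτ).2
  refine ⟨σ, s, hs, fun F => ?_⟩
  rw [componentValue_barycenter_eq hΔ h F hs (hcs τ hτ).1 hστ,
    componentValue_eq_of_chain hΔ h F hc hcs (subset_convexHull ℝ _ ⟨τ, hτ, rfl⟩) hyc]
  exact componentValue_of_mem E F hy _

end Components

/-- The two barycenters over a facet on the boundary are in the same component. -/
theorem componentValue_eq_of_boundary {n : ℕ} {Γ : ComplexIn n} {Δ : Set (Fin n → ℝ)} (hn : 1 < n)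
    (h : IsUnimodularTriangulation Γ Δ) (hΔ : Convex ℝ Δ) (hne : (interior Δ).Nonempty)
    {E : RealPhaseStructure Γ (n - 1)} (F : ConnectedComponents (tManifold Δ E) → ZMod 2)
    {τ : simplices Γ n} {v : τ.1} (hb : barycenter (facet hn τ v).1 ∉ interior Δ) {s t : Orthant n}
    (hs : s ∈ E.phase (facet hn τ v))
    (hst : s + t = (hasIntegralCoords_vertexBasis h τ).normal v) :
    componentValue E F s (barycenter (facet hn τ v).1) =
      componentValue E F t (barycenter (facet hn τ v).1) := by
  set σ := facet hn τ v with hσ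
  have hmem := barycenter_mem h σ.2.1
  have hg := Quot.sound (glued_of_notMem_interior hn h hΔ hne τ v hb
    (by rw [ZModModule.sub_eq_add, add_comm]; exact hst) hmem)
  have h1 : (Quot.mk _ ⟨s, ⟨barycenter σ.1, hmem⟩⟩ : GluedPolytope Δ) ∈ tManifold Δ E := by
    refine ⟨⟨s, ⟨barycenter σ.1, hmem⟩⟩, ⟨{σ.1}, by simp, ?_, ?_⟩, rfl⟩
    · intro a ha
      rw [Finset.mem_singleton] at ha
      rw [ha]
      exact ⟨σ.2.1, mem_orthants_of_subset hs subset_rfl⟩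
    · exact subset_convexHull ℝ _ ⟨σ.1, by simp, rfl⟩
  -- Both copies are the same point of the glued polytope, so membership at `t` needs no separate
  -- argument.
  have h2 : (Quot.mk _ ⟨t, ⟨barycenter σ.1, hmem⟩⟩ : GluedPolytope Δ) ∈ tManifold Δ E := hg ▸ h1
  rw [componentValue_of_mem E F hmem h1, componentValue_of_mem E F hmem h2]
  congr 3

/-! ### Cycles of the dual graph -/

section Cycles

variable {n : ℕ} {Γ : ComplexIn n} {Δ : Set (Fin n → ℝ)}

/-- A facet is inner when it lies in two maximal simplices. -/
def IsInner (σ : simplices Γ (n - 1)) : Prop :=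
  ∃ τ₁ τ₂ : simplices Γ n, τ₁ ≠ τ₂ ∧ σ.1 ⊆ τ₁.1 ∧ σ.1 ⊆ τ₂.1

/-- The cycles modulo two of the dual graph, as functions on the facets. -/
def facetCycles (Γ : ComplexIn n) (hn : 1 < n) :
    Submodule (ZMod 2) (simplices Γ (n - 1) → ZMod 2) where
  carrier := {w | (∀ σ, ¬ IsInner σ → w σ = 0) ∧ ∀ τ, ∑ v, w (facet hn τ v) = 0}
  zero_mem' := by simp
  add_mem' := by
    rintro w w' ⟨h1, h2⟩ ⟨h1', h2'⟩
    refine ⟨fun σ hσ => ?_, fun τ => ?_⟩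
    · rw [Pi.add_apply, h1 σ hσ, h1' σ hσ, add_zero]
    · simp only [Pi.add_apply, Finset.sum_add_distrib, h2, h2', add_zero]
  smul_mem' := by
    rintro c w ⟨h1, h2⟩
    refine ⟨fun σ hσ => ?_, fun τ => ?_⟩
    · rw [Pi.smul_apply, h1 σ hσ, smul_zero]
    · simp only [Pi.smul_apply, ← Finset.smul_sum, h2, smul_zero]

theorem eq_inter_of_subset (hn : 1 < n) {σ : simplices Γ (n - 1)} {τ₁ τ₂ : simplices Γ n}
    (hne : τ₁ ≠ τ₂) (h₁ : σ.1 ⊆ τ₁.1) (h₂ : σ.1 ⊆ τ₂.1) : σ.1 = τ₁.1 ∩ τ₂.1 := by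
  refine Finset.eq_of_subset_of_card_le (Finset.subset_inter h₁ h₂) ?_
  by_contra! hlt
  rw [σ.2.2] at hlt
  have e1 : τ₁.1 ∩ τ₂.1 = τ₁.1 := Finset.eq_of_subset_of_card_le Finset.inter_subset_left
    (by rw [τ₁.2.2]; omega)
  have e2 : τ₁.1 ∩ τ₂.1 = τ₂.1 := Finset.eq_of_subset_of_card_le Finset.inter_subset_right
    (by rw [τ₂.2.2]; omega)
  exact hne (Subtype.ext (e1.symm.trans e2))

/-- An inner facet is sent to the edge joining its two simplices. It is their intersection, so
distinct facets give distinct edges, and cycles embed into the first homology. Only this inequality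
is needed. -/
theorem finrank_facetCycles_le (hn : 1 < n) (hfin : Γ.faces.Finite) :
    Module.finrank (ZMod 2) (facetCycles Γ hn) ≤ firstBetti (dualGraph Γ Δ) := by
  classical
  have hf : ∀ k, Finite (simplices Γ k) := fun k => hfin.subset fun _ hσ => hσ.1
  have hb : Finite (boundarySimplices Γ Δ) := hfin.subset fun _ hσ => hσ.1.1
  have := Fintype.ofFinite (simplices Γ (n - 1))
  have hf' := hf n
  choose τ₁ τ₂ hne h₁ h₂ using fun σ : {σ : simplices Γ (n - 1) // IsInner σ} => σ.2
  have hadj : ∀ σ, (dualGraph Γ Δ).Adj (Sum.inl (τ₁ σ)) (Sum.inl (τ₂ σ)) := fun σ =>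
    ⟨hne σ, σ.1.1, σ.1.2, h₁ σ, h₂ σ⟩
  let edge : {σ : simplices Γ (n - 1) // IsInner σ} → (dualGraph Γ Δ).edgeSet := fun σ =>
    ⟨s(Sum.inl (τ₁ σ), Sum.inl (τ₂ σ)), hadj σ⟩
  have hedge : Function.Injective edge := by
    intro σ σ' heq
    have heq' : s(Sum.inl (τ₁ σ), Sum.inl (τ₂ σ)) =
      (s(Sum.inl (τ₁ σ'), Sum.inl (τ₂ σ')) : Sym2 (simplices Γ n ⊕ boundarySimplices Γ Δ)) :=
      congrArg Subtype.val heq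
    have e1 := eq_inter_of_subset hn (hne σ) (h₁ σ) (h₂ σ)
    have e2 := eq_inter_of_subset hn (hne σ') (h₁ σ') (h₂ σ')
    apply Subtype.ext
    apply Subtype.ext
    rw [e1, e2]
    rw [Sym2.eq_iff] at heq'
    rcases heq' with ⟨ha, hb⟩ | ⟨ha, hb⟩
    · rw [Sum.inl_injective ha, Sum.inl_injective hb]
    · rw [Sum.inl_injective ha, Sum.inl_injective hb, Finset.inter_comm]
  let Ψ : (simplices Γ (n - 1) → ZMod 2) →ₗ[ZMod 2] ((dualGraph Γ Δ).edgeSet →₀ ZMod 2) :=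
    ∑ σ : {σ : simplices Γ (n - 1) // IsInner σ},
      (LinearMap.proj σ.1).smulRight (Finsupp.single (edge σ) 1)
  have hΨ : ∀ w, Ψ w = ∑ σ : {σ : simplices Γ (n - 1) // IsInner σ},
      w σ • Finsupp.single (edge σ) 1 := by
    intro w
    simp only [Ψ, LinearMap.sum_apply, LinearMap.smulRight_apply, LinearMap.proj_apply]
  have hker : ∀ w : facetCycles Γ hn, Ψ w.1 ∈ LinearMap.ker (edgeBoundary (dualGraph Γ Δ)) := by
    rintro ⟨w, hw1, hw2⟩
    rw [LinearMap.mem_ker, hΨ, map_sum]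
    have hbd : ∀ σ, edgeBoundary (dualGraph Γ Δ) (w σ.1 • Finsupp.single (edge σ) 1) =
        w σ.1 • (Finsupp.single (Sum.inl (τ₁ σ)) 1 + Finsupp.single (Sum.inl (τ₂ σ)) 1) := by
      intro σ
      rw [map_smul, edgeBoundary, Finsupp.linearCombination_single, one_smul]
      rfl
    simp_rw [hbd]
    ext x
    rw [Finsupp.finsetSum_apply, Finsupp.zero_apply]
    rcases x with τ | σ'
    · rw [← hw2 τ, sum_facet]
      have hsub : ∑ σ : simplices Γ (n - 1), (if σ.1 ⊆ τ.1 then w σ else 0) =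
          ∑ σ ∈ Finset.univ.filter (fun σ : simplices Γ (n - 1) => IsInner σ),
            (if σ.1 ⊆ τ.1 then w σ else 0) := by
        rw [Finset.sum_filter]
        refine Finset.sum_congr rfl fun σ _ => ?_
        by_cases hσ : IsInner σ
        · rw [if_pos hσ]
        · rw [if_neg hσ, hw1 σ hσ, ite_self]
      rw [hsub, Finset.sum_subtype (p := IsInner) _ (by simp)]
      refine Finset.sum_congr rfl fun σ _ => ?_
      rw [Finsupp.smul_apply, Finsupp.add_apply, Finsupp.single_apply, Finsupp.single_apply,
        smul_eq_mul]
      simp only [Sum.inl.injEq]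
      by_cases e1 : τ₁ σ = τ
      · have e2 : τ₂ σ ≠ τ := fun e2 => hne σ (e1.trans e2.symm)
        rw [if_pos e1, if_neg e2, if_pos (e1 ▸ h₁ σ), add_zero, mul_one]
      · by_cases e2 : τ₂ σ = τ
        · rw [if_neg e1, if_pos e2, if_pos (e2 ▸ h₂ σ), zero_add, mul_one]
        · rw [if_neg e1, if_neg e2, if_neg, add_zero, mul_zero]
          intro hs
          rcases eq_or_eq_of_subset (by omega) (by rw [σ.1.2.2]; omega) (h₁ σ) (h₂ σ) hs
            (hne σ) with h | h
          · exact e1 h.symm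
          · exact e2 h.symm
    · refine Finset.sum_eq_zero fun σ _ => ?_
      simp
  refine LinearMap.finrank_le_finrank_of_injective
    (f := LinearMap.codRestrict _ (Ψ ∘ₗ (facetCycles Γ hn).subtype) hker) ?_
  intro w w' heq
  have heq' : Ψ w.1 = Ψ w'.1 := congrArg Subtype.val heq
  have hval : ∀ (w : simplices Γ (n - 1) → ZMod 2) (σ : {σ : simplices Γ (n - 1) // IsInner σ}),
      Ψ w (edge σ) = w σ := by
    intro w σ
    rw [hΨ, Finsupp.finsetSum_apply, Finset.sum_eq_single σ]
    · simp
    · intro σ' _ hσ'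
      simp [hedge.ne hσ']
    · simp
  apply Subtype.ext
  funext σ
  by_cases hσ : IsInner σ
  · rw [← hval w.1 ⟨σ, hσ⟩, ← hval w'.1 ⟨σ, hσ⟩, heq']
  · rw [w.2.1 σ hσ, w'.2.1 σ hσ]

/-- Every maximal simplex has an even number of facets that contain a given simplex of
codimension two. -/
theorem sum_facet_superset (hn : 1 < n) (τ : simplices Γ n) {ρ : Finset (Fin n → ℝ)}
    (hρ : ρ.card = n - 1) :
    ∑ v, (if ρ ⊆ (facet hn τ v).1 then (1 : ZMod 2) else 0) = 0 := by
  classical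
  by_cases hsub : ρ ⊆ τ.1
  · have hiff : ∀ v : τ.1, ρ ⊆ (facet hn τ v).1 ↔ (v : Fin n → ℝ) ∉ ρ := by
      intro v
      constructor
      · intro h hv
        simpa [facet] using h hv
      · intro hv u hu
        exact Finset.mem_erase.2 ⟨fun h => hv (h ▸ hu), hsub hu⟩
    simp_rw [hiff]
    rw [Finset.univ_eq_attach, Finset.sum_attach τ.1 (fun v => if v ∉ ρ then (1 : ZMod 2) else 0),
      Finset.sum_boole, Finset.filter_notMem_eq_sdiff, Finset.card_sdiff_of_subset hsub, τ.2.2, hρ,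
      show n + 1 - (n - 1) = 2 by omega]
    rfl
  · refine Finset.sum_eq_zero fun v _ => if_neg fun h => hsub (h.trans (facet_subset hn τ v))

end Cycles

/-! ### Intersecting cycles -/

section Jumps

variable {n : ℕ} {Γ : ComplexIn n} {Δ : Set (Fin n → ℝ)} (hn : 1 < n)
  {p q : simplices Γ (n - 1) → Orthant n}

/-- Two cycles around simplices of codimension two that cross in exactly one maximal simplex
cannot both be bounded by unions of components: there is no function on the copies of the
maximal simplices and facets, compatible with incidence, that jumps exactly along the first one. -/
theorem not_jump_iff_superset
    (hfin : Γ.faces.Finite)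
    (htrail : ∀ τ : simplices Γ n, ∃ s e, IsTrail (fun v => p (facet hn τ v))
      (fun v => q (facet hn τ v)) (Fintype.card τ.1) s e)
    (f : simplices Γ n → Orthant n → ZMod 2) (g g' : simplices Γ (n - 1) → ZMod 2)
    (hg : ∀ τ v, g (facet hn τ v) = f τ (p (facet hn τ v)))
    (hg' : ∀ τ v, g' (facet hn τ v) = f τ (q (facet hn τ v)))
    {τ₀ : simplices Γ n} {ρ ρ' : Finset (Fin n → ℝ)} (hρρ' : τ₀.1 ⊆ ρ ∪ ρ')
    (hρ' : ρ'.card = n - 1)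
    (hinner : ∀ σ : simplices Γ (n - 1), ρ' ⊆ σ.1 → IsInner σ)
    {b d : τ₀.1} (hbd : b ≠ d) (hb : ∀ v, ρ' ⊆ (facet hn τ₀ v).1 ↔ v = b ∨ v = d)
    (hcross : g (facet hn τ₀ b) ≠ g (facet hn τ₀ d))
    (hjump : ∀ σ, g σ ≠ g' σ ↔ ρ ⊆ σ.1) : False := by
  classical
  have hf : ∀ k, Finite (simplices Γ k) := fun k => hfin.subset fun _ hσ => hσ.1
  have := Fintype.ofFinite (simplices Γ (n - 1))
  have := Fintype.ofFinite (simplices Γ n)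
  let w : simplices Γ (n - 1) → ZMod 2 := fun σ => if ρ' ⊆ σ.1 then g σ else 0
  -- Every facet through `ρ'` is inner and is counted once from each of its two sides.
  have hzero : ∑ τ : simplices Γ n, ∑ v, w (facet hn τ v) = 0 := by
    simp_rw [sum_facet]
    rw [Finset.sum_comm]
    refine Finset.sum_eq_zero fun σ _ => ?_
    by_cases hσ : ρ' ⊆ σ.1
    · obtain ⟨τ₁, τ₂, hne, h₁, h₂⟩ := hinner σ hσ
      rw [Finset.sum_eq_add τ₁ τ₂ hne, if_pos h₁, if_pos h₂, CharTwo.add_self_eq_zero]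
      · intro τ _ hτ
        rw [if_neg]
        intro h
        rcases eq_or_eq_of_subset (by omega) (by rw [σ.2.2]; omega) h₁ h₂ h hne with h' | h'
        · exact hτ.1 h'
        · exact hτ.2 h'
      · simp
      · simp
    · refine Finset.sum_eq_zero fun τ _ => ?_
      simp [w, hσ]
  have hne : ∀ τ, τ ≠ τ₀ → ∑ v, w (facet hn τ v) = 0 := by
    intro τ hτ
    by_cases hτρ' : ρ' ⊆ τ.1
    · have hnojump : ∀ v, f τ (p (facet hn τ v)) = f τ (q (facet hn τ v)) := by
        intro v
        rw [← hg, ← hg']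
        by_contra hcon
        have hρ := (hjump _).1 hcon
        have hsub : τ₀.1 ⊆ τ.1 := hρρ'.trans
          (Finset.union_subset (hρ.trans (facet_subset hn τ v)) hτρ')
        have : τ₀.1 = τ.1 := Finset.eq_of_subset_of_card_le hsub (by rw [τ.2.2, τ₀.2.2])
        exact hτ (Subtype.ext this.symm)
      obtain ⟨s, e, ht⟩ := htrail τ
      have hconst := ht.const_of_no_jump (f τ) hnojump
      have hτne : Nonempty τ.1 := (Γ.nonempty_of_mem_faces τ.2.1).to_subtype
      obtain ⟨v₀⟩ := hτne
      have : ∀ v, w (facet hn τ v) =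
          f τ (p (facet hn τ v₀)) * (if ρ' ⊆ (facet hn τ v).1 then 1 else 0) := by
        intro v
        simp only [w, hg, mul_ite, mul_one, mul_zero]
        rw [hconst v v₀]
      simp_rw [this, ← Finset.mul_sum]
      rw [sum_facet_superset hn τ hρ', mul_zero]
    · refine Finset.sum_eq_zero fun v _ => if_neg fun h => hτρ' (h.trans (facet_subset hn τ v))
  rw [Finset.sum_eq_single τ₀ (fun τ _ h => hne τ h) (by simp),
    Finset.sum_eq_add b d hbd] at hzero
  · simp only [w, (hb b).2 (Or.inl rfl), (hb d).2 (Or.inr rfl), if_true] at hzero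
    exact hcross (CharTwo.add_eq_zero.1 hzero)
  · intro v _ hv
    exact if_neg fun h => ((hb v).1 h).elim hv.1 hv.2
  · simp
  · simp

end Jumps

/-! ### Maximality -/

/-- No T-curve is maximal when the triangulation has a vertex in the interior. -/
theorem not_isMaximalTCurve {n : ℕ} (hn : 3 < n) {Γ : ComplexIn n} {Δ : Set (Fin n → ℝ)}
    (h : IsUnimodularTriangulation Γ Δ) (hΔ : Convex ℝ Δ) {τ₀ : simplices Γ n} {v₀ : τ₀.1}
    (hv₀ : (v₀ : Fin n → ℝ) ∈ interior Δ) (E : RealPhaseStructure Γ (n - 1)) :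
    ¬ IsMaximalTCurve Δ E := by
  classical
  intro hmax
  have hn1 : 1 < n := by omega
  have hne : (interior Δ).Nonempty := ⟨_, hv₀⟩
  have hfs : ∀ k, Finite (simplices Γ k) := fun k => h.finite.subset fun _ hσ => hσ.1
  have := Fintype.ofFinite (simplices Γ (n - 1))
  obtain ⟨p, q, hpq, hE, hnormal⟩ := exists_phase_eq_pair hn1 h hΔ hne E
  have hp : ∀ σ, p σ ∈ E.phase σ := fun σ => (hE σ _).2 (Or.inl rfl)
  have hq : ∀ σ, q σ ∈ E.phase σ := fun σ => (hE σ _).2 (Or.inr rfl)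
  have htrail := exists_isTrail_facet hn1 h E hpq hE hnormal
  set C := ConnectedComponents (tManifold Δ E) with hC
  -- the jump of a function on the components along a facet
  let δ : (C → ZMod 2) →ₗ[ZMod 2] (simplices Γ (n - 1) → ZMod 2) :=
    { toFun := fun F σ => componentValue E F (p σ) (barycenter σ.1) +
        componentValue E F (q σ) (barycenter σ.1)
      map_add' := fun F G => by
        ext σ
        simp only [map_add, Pi.add_apply]
        ring
      map_smul' := fun c F => by
        ext σ
        simp only [map_smul, Pi.smul_apply, smul_add, RingHom.id_apply] }
  have hδ : ∀ F σ, δ F σ = componentValue E F (p σ) (barycenter σ.1) +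
      componentValue E F (q σ) (barycenter σ.1) := fun F σ => rfl
  have hτp : ∀ F (τ : simplices Γ n) v, componentValue E F (p (facet hn1 τ v))
      (barycenter (facet hn1 τ v).1) =
      componentValue E F (p (facet hn1 τ v)) (barycenter τ.1) := fun F τ v =>
    componentValue_barycenter_eq hΔ h.space_eq F (hp _) τ.2.1 (facet_subset hn1 τ v)
  have hτq : ∀ F (τ : simplices Γ n) v, componentValue E F (q (facet hn1 τ v))
      (barycenter (facet hn1 τ v).1) =
      componentValue E F (q (facet hn1 τ v)) (barycenter τ.1) := fun F τ v =>
    componentValue_barycenter_eq hΔ h.space_eq F (hq _) τ.2.1 (facet_subset hn1 τ v)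
  have hinner : ∀ σ : simplices Γ (n - 1), barycenter σ.1 ∈ interior Δ → IsInner σ := fun σ hσ =>
    exists_two_superset_simplices h hΔ σ.2.1 (by rw [σ.2.2]; omega) hσ
  -- A facet that is not inner is on the boundary, where its two copies are glued. At a maximal
  -- simplex, each orthant occurs an even number of times among the ends of the facets.
  have hδcycle : ∀ F, δ F ∈ facetCycles Γ hn1 := by
    intro F
    refine ⟨fun σ hσ => ?_, fun τ => ?_⟩
    · obtain ⟨τ, hτ⟩ := exists_superset_simplex h hΔ hne σ.2.1
      obtain ⟨v, rfl⟩ := exists_facet_eq hn1 hτ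
      rw [hδ, componentValue_eq_of_boundary hn1 h hΔ hne F (fun hb => hσ (hinner _ hb)) (hp _)
        (hnormal τ v), CharTwo.add_self_eq_zero]
    · have hs := sum_ends_facet hn1 E hpq hE τ
      have hs' := congrArg (Finsupp.linearCombination (ZMod 2)
        fun s => componentValue E F s (barycenter τ.1)) hs
      rw [map_sum, map_zero] at hs'
      rw [← hs']
      refine Finset.sum_congr rfl fun v _ => ?_
      rw [hδ, hτp, hτq, ends, map_add, Finsupp.linearCombination_single,
        Finsupp.linearCombination_single, one_smul, one_smul]
  -- the kernel consists of constants
  have hconst : ∀ F, δ F = 0 → ∃ c, F = fun _ => c := by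
    intro F hF
    have hF' : ∀ σ, componentValue E F (p σ) (barycenter σ.1) =
        componentValue E F (q σ) (barycenter σ.1) := fun σ =>
      CharTwo.add_eq_zero.1 (congrFun hF σ)
    have hlocal : ∀ τ v w, componentValue E F (p (facet hn1 τ v)) (barycenter τ.1) =
        componentValue E F (p (facet hn1 τ w)) (barycenter τ.1) := by
      intro τ
      obtain ⟨s, e, ht⟩ := htrail τ
      exact ht.const_of_no_jump (fun s => componentValue E F s (barycenter τ.1)) fun v => by
        rw [← hτp, ← hτq, hF']
    set c := componentValue E F (p (facet hn1 τ₀ v₀)) (barycenter τ₀.1) with hc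
    have hglobal : ∀ τ v, componentValue E F (p (facet hn1 τ v)) (barycenter τ.1) = c := by
      intro τ
      refine forall_simplices_of_adjacent h hΔ
        (fun τ => ∀ v, componentValue E F (p (facet hn1 τ v)) (barycenter τ.1) = c) ?_
        (τ₁ := τ₀) fun v => hlocal τ₀ v v₀
      intro τ₁ τ₂ hcard h₁ v
      -- The constant passes from one simplex to the next through a copy of their common facet.
      have hface : τ₁.1 ∩ τ₂.1 ∈ Γ.faces := Γ.down_closed τ₁.2.1 Finset.inter_subset_left
        (Finset.card_pos.1 (by omega))
      let σ : simplices Γ (n - 1) := ⟨τ₁.1 ∩ τ₂.1, hface, by omega⟩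
      obtain ⟨w₁, hw₁⟩ := exists_facet_eq hn1 (τ := τ₁) (σ := σ) Finset.inter_subset_left
      obtain ⟨w₂, hw₂⟩ := exists_facet_eq hn1 (τ := τ₂) (σ := σ) Finset.inter_subset_right
      rw [hlocal τ₂ v w₂, ← hτp, hw₂, ← hw₁, hτp, h₁]
    refine ⟨c, funext fun x => ?_⟩
    obtain ⟨σ, s, hs, hx⟩ := exists_componentValue_eq hΔ h.space_eq x
    obtain ⟨τ, hτ⟩ := exists_superset_simplex h hΔ hne σ.2.1
    obtain ⟨v, rfl⟩ := exists_facet_eq hn1 hτ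
    rw [← hx F, ← hglobal τ v, ← hτp]
    rcases (hE _ _).1 hs with rfl | rfl
    · rfl
    · exact (hF' _).symm
  -- finiteness
  have hCfin : Finite C := by
    -- Each component is determined by a facet and an orthant, of which there are finitely many.
    choose σ s hs hx using exists_componentValue_eq (E := E) hΔ h.space_eq
    have hfinQ : Finite (Orthant n) :=
      Finite.of_injective (fun l : Orthant n => (l : (Fin n → ZMod 2) → ZMod 2))
        DFunLike.coe_injective
    refine Finite.of_injective (fun x : C => (σ x, s x)) fun x y hxy => ?_
    have h1 : σ x = σ y := congrArg Prod.fst hxy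
    have h2 : s x = s y := congrArg Prod.snd hxy
    have h3 := hx x (Pi.single x 1)
    rw [h1, h2, hx y, Pi.single_eq_same] at h3
    by_contra hxy'
    rw [Pi.single_eq_of_ne (Ne.symm hxy')] at h3
    exact zero_ne_one h3
  have := Fintype.ofFinite C
  have hkerle : Module.finrank (ZMod 2) (LinearMap.ker δ) ≤ 1 := by
    have hle : LinearMap.ker δ ≤ Submodule.span (ZMod 2) {fun _ => 1} := by
      intro F hF
      obtain ⟨c, rfl⟩ := hconst F hF
      refine Submodule.mem_span_singleton.2 ⟨c, ?_⟩
      ext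
      simp
    refine (Submodule.finrank_mono hle).trans ?_
    simpa using finrank_span_le_card (R := ZMod 2) ({fun _ => 1} : Set (C → ZMod 2))
  -- the cycle around a simplex of codimension two that is not a jump
  have hlt : LinearMap.range δ < facetCycles Γ hn1 := by
    have hle : LinearMap.range δ ≤ facetCycles Γ hn1 := by
      rintro _ ⟨F, rfl⟩
      exact hδcycle F
    refine lt_of_le_of_ne hle fun heq => ?_
    obtain ⟨s, e, ht⟩ := htrail τ₀
    -- This is where n ≥ 4 enters: the n + 1 ≥ 5 facets leave four besides the one opposite to `v₀`.
    obtain ⟨a, b, c, d, hav, hbv, hcv, hdv, hab, hac, had, hbc, hbd, hcd, hcross⟩ :=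
      ht.exists_interlaced (by rw [Fintype.card_coe, τ₀.2.2]; omega) v₀
    -- the simplex of codimension two opposite to the edge `x y`
    have hopp : ∀ x y : τ₀.1, x ≠ y → ∀ v, τ₀.1 \ {x.1, y.1} ⊆ (facet hn1 τ₀ v).1 ↔
        v = x ∨ v = y := by
      intro x y hxy v
      constructor
      · intro hs
        by_contra! hcon
        have : v.1 ∈ τ₀.1 \ {x.1, y.1} := by
          simp only [Finset.mem_sdiff, v.2, Finset.mem_insert, Finset.mem_singleton, true_and]
          rintro (h' | h')
          · exact hcon.1 (Subtype.ext h')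
          · exact hcon.2 (Subtype.ext h')
        have := hs this
        simp [facet] at this
      · intro hv u hu
        simp only [Finset.mem_sdiff, Finset.mem_insert, Finset.mem_singleton, not_or] at hu
        refine Finset.mem_erase.2 ⟨?_, hu.1⟩
        rcases hv with rfl | rfl
        · exact hu.2.1
        · exact hu.2.2
    have hcard : ∀ x y : τ₀.1, x ≠ y → (τ₀.1 \ {x.1, y.1}).card = n - 1 := by
      intro x y hxy
      rw [Finset.card_sdiff_of_subset (by
        intro u hu
        simp only [Finset.mem_insert, Finset.mem_singleton] at hu
        rcases hu with rfl | rfl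
        · exact x.2
        · exact y.2), τ₀.2.2, Finset.card_pair fun h' => hxy (Subtype.ext h')]
      omega
    -- These faces of codimension two contain the interior point `v₀`, so no facet through them is
    -- on the boundary.
    have hin : ∀ x y : τ₀.1, x ≠ v₀ → y ≠ v₀ → ∀ σ : simplices Γ (n - 1),
        τ₀.1 \ {x.1, y.1} ⊆ σ.1 → IsInner σ := by
      intro x y hx hy σ hσ
      refine hinner σ (barycenter_mem_interior h hΔ σ.2.1 (hσ ?_) hv₀)
      simp only [Finset.mem_sdiff, v₀.2, Finset.mem_insert, Finset.mem_singleton, true_and]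
      rintro (h' | h')
      · exact hx (Subtype.ext h'.symm)
      · exact hy (Subtype.ext h'.symm)
    set ρ := τ₀.1 \ {a.1, c.1} with hρ
    set ρ' := τ₀.1 \ {b.1, d.1} with hρ'
    have hw : (fun σ : simplices Γ (n - 1) => if ρ ⊆ σ.1 then (1 : ZMod 2) else 0) ∈
        facetCycles Γ hn1 :=
      ⟨fun σ hσ => if_neg fun hs => hσ (hin a c hav hcv σ hs),
        fun τ => sum_facet_superset hn1 τ (hcard a c hac)⟩
    rw [← heq] at hw
    obtain ⟨F, hF⟩ := hw
    have h01 : ∀ x y : ZMod 2, x ≠ y ↔ x + y = 1 := by decide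
    have hjump : ∀ σ : simplices Γ (n - 1), componentValue E F (p σ) (barycenter σ.1) ≠
        componentValue E F (q σ) (barycenter σ.1) ↔ ρ ⊆ σ.1 := by
      intro σ
      rw [h01, ← hδ, hF]
      by_cases hs : ρ ⊆ σ.1 <;> simp [hs]
    refine not_jump_iff_superset hn1 h.finite htrail
      (fun τ s => componentValue E F s (barycenter τ.1))
      (fun σ => componentValue E F (p σ) (barycenter σ.1))
      (fun σ => componentValue E F (q σ) (barycenter σ.1)) (hτp F) (hτq F) (τ₀ := τ₀)
      (ρ := ρ) (ρ' := ρ') ?_ (hcard b d hbd) (hin b d hbv hdv) hbd (hopp b d hbd) ?_ hjump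
    · intro u hu
      rw [Finset.mem_union, hρ, hρ', Finset.mem_sdiff, Finset.mem_sdiff]
      by_contra! hcon
      have e1 := hcon.1 hu
      have e2 := hcon.2 hu
      simp only [Finset.mem_insert, Finset.mem_singleton] at e1 e2
      rcases e1 with e1 | e1 <;> rcases e2 with e2 | e2 <;> rw [e1] at e2
      · exact hab (Subtype.ext e2)
      · exact had (Subtype.ext e2)
      · exact hbc (Subtype.ext e2.symm)
      · exact hcd (Subtype.ext e2)
    · rw [hτp, hτp]
      refine hcross (fun s => componentValue E F s (barycenter τ₀.1)) fun v => ?_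
      rw [← hτp, ← hτq, hjump, hopp a c hac]
  -- The kernel has dimension at most 1 and the range less than b₁, so b₀ ≤ b₁.
  have hrank := LinearMap.finrank_range_add_finrank_ker δ
  rw [Module.finrank_fintype_fun_eq_card] at hrank
  have hlt' := Submodule.finrank_lt_finrank_of_lt hlt
  have hbetti := finrank_facetCycles_le (Δ := Δ) hn1 h.finite
  have hcard : (Fintype.card C : ℕ∞) = (firstBetti (dualGraph Γ Δ) : ℕ∞) + 1 := by
    rw [← hmax, numComponents, ← hC, ENat.card_eq_coe_fintype_card]
  have hcard' : Fintype.card C = firstBetti (dualGraph Γ Δ) + 1 := by exact_mod_cast hcard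
  omega

/-! ### Interior lattice points of dilated polytopes -/

section Dilation

variable {n : ℕ} {Δ : Set (Fin n → ℝ)}

theorem IsLatticePolytope.convex (h : IsLatticePolytope Δ) : Convex ℝ Δ := by
  obtain ⟨⟨S, rfl⟩, -⟩ := h
  exact convex_convexHull ℝ _

theorem IsLatticePolytope.smul (h : IsLatticePolytope Δ) {d : ℕ} (hd : d ≠ 0) :
    IsLatticePolytope ((d : ℝ) • Δ) := by
  classical
  have hd' : (d : ℝ) ≠ 0 := by exact_mod_cast hd
  refine ⟨?_, ?_⟩
  · obtain ⟨⟨S, rfl⟩, -⟩ := h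
    refine ⟨S.image fun a => (d : ℤ) • a, ?_⟩
    rw [← convexHull_smul, Finset.coe_image, Set.image_image, ← Set.image_smul, Set.image_image]
    congr 2
    ext a i
    simp [latticePoint]
  · rw [interior_smul₀ hd']
    exact h.2.smul_set

theorem IsLatticePolytope.exists_affineBasis (h : IsLatticePolytope Δ) :
    ∃ (s : Set (Fin n → ℝ)) (b : AffineBasis s ℝ (Fin n → ℝ)), s.Finite ∧
      (∀ i, ∃ a, b i = latticePoint a) ∧ ∀ i, b i ∈ Δ := by
  obtain ⟨⟨S, rfl⟩, hne⟩ := h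
  rw [interior_convexHull_nonempty_iff_affineSpan_eq_top] at hne
  obtain ⟨s, hs, b, hb⟩ := AffineBasis.exists_affine_subbasis hne
  refine ⟨s, b, (S.finite_toSet.image _).subset hs, fun i => ?_, fun i => ?_⟩
  · obtain ⟨a, -, ha⟩ := hs i.2
    exact ⟨a, by rw [hb]; exact ha.symm⟩
  · rw [hb]
    exact subset_convexHull ℝ _ (hs i.2)

/-- A lattice point that is a positive combination of total weight `m` of an affine basis of
lattice points of a polytope, and possibly one more point, yields interior lattice points of all
dilations by factors at least `m`. -/
theorem hasInteriorLatticePoint_smul {ι : Type*} [Fintype ι] (hΔ : Convex ℝ Δ)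
    (b : AffineBasis ι ℝ (Fin n → ℝ)) (hb : ∀ i, ∃ a, b i = latticePoint a) (hbΔ : ∀ i, b i ∈ Δ)
    {x : Fin n → ℝ} (hx : x ∈ Δ) {cx : ℝ} (hcx : 0 ≤ cx) {c : ι → ℝ} (hc : ∀ i, 0 < c i) {m d : ℕ}
    (hm : cx + ∑ i, c i = m) (hmd : m ≤ d) {w : Fin n → ℤ}
    (hw : cx • x + ∑ i, c i • b i = latticePoint w) :
    HasInteriorLatticePoint ((d : ℝ) • Δ) := by
  classical
  obtain ⟨i₀⟩ := b.nonempty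
  obtain ⟨a, ha⟩ := hb i₀
  have hmd' : (0 : ℝ) ≤ (d : ℝ) - m := sub_nonneg.2 (by exact_mod_cast hmd)
  -- Adding the lattice vertex `b i₀` with multiplicity `d - m` raises the total weight to `d` and
  -- keeps the point in the lattice.
  set e : ι → ℝ := c + Pi.single i₀ ((d : ℝ) - m) with he
  have hepos : ∀ i, 0 < e i := by
    intro i
    rw [he, Pi.add_apply]
    by_cases hi : i = i₀
    · subst hi
      rw [Pi.single_eq_same]
      linarith [hc i]
    · rw [Pi.single_eq_of_ne hi, add_zero]
      exact hc i
  have hesum : ∑ i, e i = d - cx := by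
    simp only [he, Pi.add_apply, Finset.sum_add_distrib, Finset.sum_pi_single', Finset.mem_univ,
      if_true]
    linarith
  have hC : 0 < (d : ℝ) - cx := by
    rw [← hesum]
    exact Finset.sum_pos (fun i _ => hepos i) ⟨i₀, Finset.mem_univ _⟩
  have hd : (0 : ℝ) < d := by linarith
  have hecomb : cx • x + ∑ i, e i • b i = latticePoint (w + ((d : ℤ) - m) • a) := by
    have : ∑ i, e i • b i = ∑ i, c i • b i + ((d : ℝ) - m) • b i₀ := by
      simp only [he, Pi.add_apply, add_smul, Finset.sum_add_distrib]
      rw [Finset.sum_eq_single (f := fun i => (Pi.single i₀ ((d : ℝ) - m) : ι → ℝ) i • b i) i₀]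
      · rw [Pi.single_eq_same]
      · intro i _ hi
        rw [Pi.single_eq_of_ne hi, zero_smul]
      · simp
    rw [this, ← add_assoc, hw, ha, latticePoint_add]
    congr 1
    ext j
    simp [latticePoint]
  have hy : ∑ i, (e i / (d - cx)) • b i ∈ interior Δ := by
    have hsub : convexHull ℝ (Set.range b) ⊆ Δ := by
      refine convexHull_min ?_ hΔ
      rintro _ ⟨i, rfl⟩
      exact hbΔ i
    refine interior_mono hsub ?_
    rw [b.interior_convexHull]
    intro i
    have h1 : ∑ i, e i / (d - cx) = 1 := by
      rw [← Finset.sum_div, hesum, div_self hC.ne']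
    rw [← Finset.univ.affineCombination_eq_linear_combination _ _ h1,
      b.coord_apply_combination_of_mem (Finset.mem_univ i) h1]
    exact div_pos (hepos i) hC
  -- After division by `d`, the lattice point is a convex combination of `x` and an interior point,
  -- the latter with positive weight.
  have hz := hΔ.combo_interior_self_mem_interior hy hx (a := (d - cx) / d) (b := cx / d)
    (div_pos hC hd) (div_nonneg hcx hd.le) (by field_simp; ring)
  refine ⟨w + ((d : ℤ) - m) • a, ?_⟩
  rw [interior_smul₀ hd.ne', ← hecomb]
  refine ⟨_, hz, ?_⟩
  show (d : ℝ) • _ = _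
  rw [smul_add, smul_smul, smul_smul, mul_div_cancel₀ _ hd.ne', mul_div_cancel₀ _ hd.ne',
    Finset.smul_sum, add_comm]
  congr 1
  refine Finset.sum_congr rfl fun i _ => ?_
  rw [smul_smul, mul_div_cancel₀ _ hC.ne']

theorem latticePoint_sum {ι : Type*} (s : Finset ι) (a : ι → Fin n → ℤ) :
    latticePoint (∑ i ∈ s, a i) = ∑ i ∈ s, latticePoint (a i) := by
  ext j
  simp [latticePoint]

theorem card_affineBasis {ι : Type*} [Fintype ι] (b : AffineBasis ι ℝ (Fin n → ℝ)) :
    Fintype.card ι = n + 1 := by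
  rw [b.card_eq_finrank_add_one, Module.finrank_fin_fun]

/-- The sum of the n + 1 vertices of a lattice simplex in Δ has total weight n + 1; the extra point
gets weight 0. -/
theorem IsLatticePolytope.hasInteriorLatticePoint_of_succ_le (h : IsLatticePolytope Δ) {d : ℕ}
    (hd : n + 1 ≤ d) : HasInteriorLatticePoint ((d : ℝ) • Δ) := by
  obtain ⟨s, b, hs, hb, hbΔ⟩ := h.exists_affineBasis
  have := hs.fintype
  obtain ⟨i₀⟩ := b.nonempty
  choose a ha using hb
  refine hasInteriorLatticePoint_smul h.convex b (fun i => ⟨a i, ha i⟩) hbΔ (hbΔ i₀) le_rfl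
    (c := fun _ => 1) (fun _ => one_pos) (m := n + 1) ?_ hd (w := ∑ i, a i) ?_
  · simp [card_affineBasis b]
  · rw [latticePoint_sum]
    simp [ha]

/-- A nonunimodular simplex in `Δ` gives interior lattice points of `d • Δ` for `n ≤ d`. -/
theorem hasInteriorLatticePoint_of_not_hasIntegralCoords {ι : Type*} [Fintype ι]
    (hΔ : Convex ℝ Δ) (b : AffineBasis ι ℝ (Fin n → ℝ)) (hb : ∀ i, ∃ a, b i = latticePoint a)
    (hbΔ : ∀ i, b i ∈ Δ) (hint : ¬ HasIntegralCoords b) {d : ℕ} (hd : n ≤ d) :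
    HasInteriorLatticePoint ((d : ℝ) • Δ) := by
  unfold HasIntegralCoords at hint
  push Not at hint
  obtain ⟨i, w, hi⟩ := hint
  choose a ha using hb
  set l : ι → ℝ := fun j => (b.coord j).linear (latticePoint w) with hl
  have hlc : ∀ j, l j = b.coord j (latticePoint w) - b.coord j 0 := fun j => by
    rw [affineBasis_coord_sub_coord, sub_zero]
  have hlsum : ∑ j, l j = 0 := by
    simp_rw [hlc, Finset.sum_sub_distrib, b.sum_coord_apply_eq_one, sub_self]
  have hlw : ∑ j, l j • b j = latticePoint w := by
    simp_rw [hlc, sub_smul, Finset.sum_sub_distrib, b.linear_combination_coord_eq_self, sub_zero]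
  -- Shifting the weights of `w` by integers into (0, 1] keeps the combination in the lattice. Their
  -- sum is an integer, and it is less than n + 1 because the weight at `i` is not 1.
  have hcsum : ∑ j, (l j - ⌈l j⌉ + 1) = ((∑ j, (1 - ⌈l j⌉) : ℤ) : ℝ) := by
    push_cast
    rw [Finset.sum_add_distrib, Finset.sum_sub_distrib, Finset.sum_sub_distrib, hlsum]
    ring
  have hcpos : ∀ j, 0 < l j - ⌈l j⌉ + 1 := fun j => by linarith [Int.ceil_lt_add_one (l j)]
  have hcle : ∀ j, l j - ⌈l j⌉ + 1 ≤ 1 := fun j => by linarith [Int.le_ceil (l j)]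
  have hclt : l i - ⌈l i⌉ + 1 < 1 := by
    have := lt_of_le_of_ne (Int.le_ceil (l i)) (hi _)
    linarith
  have hlt : ∑ j, (l j - ⌈l j⌉ + 1) < n + 1 := by
    have := Finset.sum_lt_sum (fun j (_ : j ∈ Finset.univ) => hcle j) ⟨i, Finset.mem_univ i, hclt⟩
    simpa [card_affineBasis b] using this
  have hpos : 0 ≤ ∑ j, (l j - ⌈l j⌉ + 1) := Finset.sum_nonneg fun j _ => (hcpos j).le
  rw [hcsum] at hlt hpos
  obtain ⟨m, hm⟩ := Int.eq_ofNat_of_zero_le (by exact_mod_cast hpos : 0 ≤ ∑ j, (1 - ⌈l j⌉))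
  rw [hm] at hlt
  have hmn : m < n + 1 := by exact_mod_cast hlt
  refine hasInteriorLatticePoint_smul hΔ b (fun i => ⟨a i, ha i⟩) hbΔ (hbΔ i) le_rfl hcpos
    (m := m) ?_ (by omega : m ≤ d) (w := w + ∑ j, (1 - ⌈l j⌉) • a j) ?_
  · rw [zero_add, hcsum, hm]
    rfl
  · rw [latticePoint_add, latticePoint_sum, zero_smul, zero_add]
    have : ∀ j, latticePoint ((1 - ⌈l j⌉) • a j) = (1 - (⌈l j⌉ : ℝ)) • b j := by
      intro j
      rw [ha]
      ext k
      simp [latticePoint]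
    simp_rw [this]
    rw [← hlw, ← Finset.sum_add_distrib]
    refine Finset.sum_congr rfl fun j _ => ?_
    rw [← add_smul]
    congr 1
    ring

/-- If `Δ` is larger than a lattice simplex in it, then `d • Δ` has interior lattice points for
`n ≤ d`. -/
theorem hasInteriorLatticePoint_of_notMem_convexHull {ι : Type*} [Fintype ι]
    (hΔ : Convex ℝ Δ) (b : AffineBasis ι ℝ (Fin n → ℝ)) (hb : ∀ i, ∃ a, b i = latticePoint a)
    (hbΔ : ∀ i, b i ∈ Δ) {x : Fin n → ℝ} (hx : x ∈ Δ) (hxb : x ∉ convexHull ℝ (Set.range b))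
    {d : ℕ} (hd : n ≤ d) : HasInteriorLatticePoint ((d : ℝ) • Δ) := by
  classical
  rw [b.convexHull_eq_nonneg_coord] at hxb
  obtain ⟨i, hi⟩ : ∃ i, b.coord i x < 0 := by
    by_contra! hcon
    exact hxb hcon
  choose a ha using hb
  set μ : ι → ℝ := fun j => b.coord j x with hμ
  set N : Finset ι := Finset.univ.filter fun j => ¬ μ j < 0 with hN
  -- a small positive number
  obtain ⟨ε, hε, hεμ⟩ : ∃ ε : ℝ, 0 < ε ∧ ∀ j, ε * μ j < 1 := by
    have hlim : ∀ᶠ ε in nhdsWithin (0 : ℝ) (Set.Ioi 0), ∀ j, ε * μ j < 1 := by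
      rw [Filter.eventually_all]
      intro j
      have : Filter.Tendsto (fun ε : ℝ => ε * μ j) (nhds 0) (nhds (0 * μ j)) :=
        (continuous_id.mul continuous_const).tendsto 0
      rw [zero_mul] at this
      exact nhdsWithin_le_nhds (this.eventually (gt_mem_nhds one_pos))
    obtain ⟨ε, h1, h2⟩ := (hlim.and self_mem_nhdsWithin).exists
    exact ⟨ε, h2, h1⟩
  have hμsum : ∑ j, μ j = 1 := b.sum_coord_apply_eq_one x
  have hμx : ∑ j, μ j • b j = x := b.linear_combination_coord_eq_self x
  -- The coordinate of `x` at `i` is negative, so `N` omits at least one of the n + 1 vertices.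
  have hNcard : N.card ≤ n := by
    have : N ⊂ Finset.univ := by
      rw [Finset.ssubset_univ_iff]
      intro h
      have := h ▸ Finset.mem_univ i
      rw [hN, Finset.mem_filter] at this
      exact this.2 hi
    have := Finset.card_lt_card this
    rw [Finset.card_univ, card_affineBasis b] at this
    omega
  -- The sum of the vertices in `N` is rewritten by adding and subtracting `ε • x`: off `N` the
  -- weights `-ε μ j` are positive, and on `N` they stay positive because `ε μ j < 1`.
  refine hasInteriorLatticePoint_smul hΔ b (fun i => ⟨a i, ha i⟩) hbΔ hx hε.le
    (c := fun j => (if j ∈ N then 1 else 0) - ε * μ j) ?_ (m := N.card) ?_ (hNcard.trans hd)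
    (w := ∑ j ∈ N, a j) ?_
  · intro j
    by_cases hj : μ j < 0
    · have hjN : j ∉ N := by simp [hN, hj]
      simp only [if_neg hjN]
      linarith [mul_neg_of_pos_of_neg hε hj]
    · have hjN : j ∈ N := by simp [hN, not_lt.1 hj]
      simp only [if_pos hjN]
      linarith [hεμ j]
  · rw [Finset.sum_sub_distrib, ← Finset.mul_sum, hμsum]
    simp
  · simp_rw [sub_smul, Finset.sum_sub_distrib, mul_smul, ← Finset.smul_sum, hμx, latticePoint_sum]
    simp [ha]

theorem isUnimodularSimplex_convexHull {ι : Type*} [Fintype ι] (b : AffineBasis ι ℝ (Fin n → ℝ))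
    (hb : ∀ i, ∃ a, b i = latticePoint a) (h : HasIntegralCoords b) :
    IsUnimodularSimplex (convexHull ℝ (Set.range b)) := by
  classical
  have hcoe : ((Finset.univ.image b : Finset (Fin n → ℝ)) : Set (Fin n → ℝ)) = Set.range b := by
    simp
  refine ⟨Finset.univ.image b, ?_, ?_, ?_, by rw [hcoe], ?_⟩
  · rw [Finset.card_image_of_injective _ b.ind.injective, Finset.card_univ, card_affineBasis b]
  · have hr : AffineIndependent ℝ ((↑) : Set.range b → (Fin n → ℝ)) := b.ind.range
    rw [← hcoe] at hr
    exact hr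
  · intro v hv
    obtain ⟨i, -, rfl⟩ := Finset.mem_image.1 hv
    exact hb i
  · exact (volume_eq_iff_hasIntegralCoords (card_affineBasis b) b hb).2 h

/-- A full-dimensional lattice simplex in Δ is either not unimodular or, when Δ is no unimodular
simplex, not all of Δ; each case supplies weight at most n. -/
theorem IsLatticePolytope.hasInteriorLatticePoint_of_le (h : IsLatticePolytope Δ)
    (hs : ¬ IsUnimodularSimplex Δ) {d : ℕ} (hd : n ≤ d) :
    HasInteriorLatticePoint ((d : ℝ) • Δ) := by
  obtain ⟨s, b, hfin, hb, hbΔ⟩ := h.exists_affineBasis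
  have := hfin.fintype
  by_cases hint : HasIntegralCoords b
  · have hsub : convexHull ℝ (Set.range b) ⊆ Δ := by
      refine convexHull_min ?_ h.convex
      rintro _ ⟨i, rfl⟩
      exact hbΔ i
    obtain ⟨x, hx, hxb⟩ : ∃ x ∈ Δ, x ∉ convexHull ℝ (Set.range b) := by
      by_contra! hcon
      exact hs (hsub.antisymm hcon ▸ isUnimodularSimplex_convexHull b hb hint)
    exact hasInteriorLatticePoint_of_notMem_convexHull h.convex b hb hbΔ hx hxb hd
  · exact hasInteriorLatticePoint_of_not_hasIntegralCoords h.convex b hb hbΔ hint hd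

end Dilation

/-- Unimodular simplices have no lattice points besides their vertices, so an interior lattice point
is a vertex of any such triangulation. -/
theorem not_hasMaximalTCurve {n : ℕ} (hn : 3 < n) {Δ : Set (Fin n → ℝ)} (hΔ : IsLatticePolytope Δ)
    (hint : HasInteriorLatticePoint Δ) : ¬ HasMaximalTCurve Δ := by
  rintro ⟨Γ, h, E, hE⟩
  obtain ⟨a, ha⟩ := hint
  obtain ⟨τ, hτ, haτ⟩ := exists_simplex_mem h hΔ.convex hΔ.2 (interior_subset ha)
  rw [← range_vertexBasis ⟨τ, hτ⟩] at haτ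
  obtain ⟨v, hv⟩ := (hasIntegralCoords_vertexBasis h ⟨τ, hτ⟩).exists_eq_of_mem_convexHull
    (vertexBasis_integral h ⟨τ, hτ⟩) haτ
  rw [vertexBasis_apply] at hv
  exact not_isMaximalTCurve hn h hΔ.convex (τ₀ := ⟨τ, hτ⟩) (v₀ := v) (hv ▸ ha) E hE

end Patchworking

theorem mainTheorem3 (n : ℕ) (hn : 3 < n) (Δ : Set (Fin n → ℝ))
    (hΔ : Patchworking.IsLatticePolytope Δ) :
    (Patchworking.HasInteriorLatticePoint Δ → ¬ Patchworking.HasMaximalTCurve Δ) ∧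
    (∀ d : ℕ, n + 1 ≤ d → ¬ Patchworking.HasMaximalTCurve ((d : ℝ) • Δ)) ∧
    (¬ Patchworking.IsUnimodularSimplex Δ →
      ∀ d : ℕ, n ≤ d → ¬ Patchworking.HasMaximalTCurve ((d : ℝ) • Δ)) :=
  ⟨Patchworking.not_hasMaximalTCurve hn hΔ,
    fun _ hd => Patchworking.not_hasMaximalTCurve hn (hΔ.smul (by omega))
      (hΔ.hasInteriorLatticePoint_of_succ_le hd),
    fun hs _ hd => Patchworking.not_hasMaximalTCurve hn (hΔ.smul (by omega))
      (hΔ.hasInteriorLatticePoint_of_le hs hd)⟩
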